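/- Let $\sigma\in\mathbb{R}$, $q_0>0$, and let $\mathbf{q}_\pm\in\mathbb{C}^2$ satisfy $\|\mathbf{q}_\pm\|=q_0$ and be non-parallel, i.e. $|\mathbf{q}_+^\dagger\mathbf{q}_-|<q_0^2$ (the orthogonal case $\mathbf{q}_+^\dagger\mathbf{q}_-=0$ is included). Let $\mathbf{q}(x,t)\in\mathbb{C}^2$, $(x,t)\in\mathbb{R}^2$, be a classical solution of the defocusing-defocusing coupled Hirota equations $$\mathrm{i}\mathbf{q}_t+\mathbf{q}_{xx}-2(\|\mathbf{q}\|^2-q_0^2)\mathbf{q}+\mathrm{i}\sigma\left[\mathbf{q}_{xxx}-3\|\mathbf{q}\|^2\mathbf{q}_x-3(\mathbf{q}^\dagger\mathbf{q}_x)\mathbf{q}\right]=\mathbf{0}$$ such that for every $t$: $\lim_{x\to\pm\infty}\mathbf{q}(x,t)=\mathbf{q}_\pm$, $\mathbf{q}(\cdot,t)-\mathbf{q}_-\in L^1(-\infty,0)$ and $\mathbf{q}(\cdot,t)-\mathbf{q}_+\in L^1(0,\infty)$. For real $z\notin\{0,\pm q_0\}$ put $k=\frac12(z+q_0^2/z)$,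 $\lambda=\frac12(z-q_0^2/z)$, $\widehat\rho=z^2/(z^2-q_0^2)$, $\mathbf{v}^\perp=(v_2,-v_1)^\dagger$, $$\mathbf{J}=\operatorname{diag}(1,-1,-1),\quad \mathbf{Q}=\begin{pmatrix}0&-\mathbf{q}^\dagger\\ \mathbf{q}&\mathbf{0}\end{pmatrix},\quad \widehat{\mathbf{Y}}_\pm=\begin{pmatrix}\mathrm{i}\widehat\rho&0&\widehat\rho q_0/z\\ \mathrm{i}\widehat\rho\,\mathbf{q}_\pm/z&\mathbf{q}_\pm^\perp/q_0&\widehat\rho\,\mathbf{q}_\pm/q_0\end{pmatrix},$$ $\mathbf{\Delta}=\operatorname{diag}(\delta_1,\delta_2,-\delta_1)$, $\delta_1=\lambda x+2\lambda[k+\sigma(3k^2-\lambda^2)]t$, $\delta_2=-kx-(\lambda^2+k^2+4\sigma k^3)t$. The Jost solutions $\psi_\pm(z;x,t)$ are the $3\times3$ matrix solutions of $\psi_x=(\mathrm{i}k\mathbf{J}+\mathrm{i}\mathbf{Q})\psi$ with $\psi_\pm=\widehat{\mathbf{Y}}_\pm\mathrm{e}^{\mathrm{i}\mathbf{\Delta}}+o(1)$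 as $x\to\pm\infty$; the scattering matrix $\mathbf{H}=(h_{ij})$ is defined by $\psi_+=\psi_-\mathbf{H}$, $\mathbf{S}=\mathbf{H}^{-1}=(s_{ij})$, and the reflection coefficients are $\beta_1=s_{13}/s_{11}$ and $\beta_2=h_{21}/h_{11}$. Then, at every time $t$, the scattering matrix $\mathbf{H}(z)$ exists and is unique for all $z\in\mathbb{R}\setminus\{0,\pm q_0\}$, and $\mathbf{q}$ is not reflectionless: it is impossible that for all $z\in\mathbb{R}\setminus\{0,\pm q_0\}$ both reflection coefficients are defined ($s_{11}(z)\ne0$, $h_{11}(z)\ne0$) and $\beta_1(z)=\beta_2(z)=0$. In other words, there are no pure soliton solutions with non-parallel boundary values. -/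

import Mathlib

open Complex Filter Topology MeasureTheory

noncomputable section

namespace CoupledHirota

/-- `q` is a classical solution on `ℝ × ℝ` of the defocusing-defocusing coupled Hirota equations
`i q_t + q_xx - 2 (‖q‖² - q₀²) q + i σ (q_xxx - 3 ‖q‖² q_x - 3 (q† q_x) q) = 0`;
the first argument of `q` is `x`, the second is `t`, and `inner ℂ u v = u† v`. -/
structure IsSolution (σ q₀ : ℝ) (q : ℝ → ℝ → EuclideanSpace ℂ (Fin 2)) : Prop where
  contDiff_x : ∀ t, ContDiff ℝ 3 (fun x => q x t)
  differentiable_t : ∀ x, Differentiable ℝ (fun t => q x t)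
  equation : ∀ x t,
    I • deriv (fun s => q x s) t + iteratedDeriv 2 (fun y => q y t) x
      - ((2 * (‖q x t‖ ^ 2 - q₀ ^ 2) : ℝ) : ℂ) • q x t
      + (I * (σ : ℂ)) • (iteratedDeriv 3 (fun y => q y t) x
          - ((3 * ‖q x t‖ ^ 2 : ℝ) : ℂ) • deriv (fun y => q y t) x
          - (3 * inner ℂ (q x t) (deriv (fun y => q y t) x)) • q x t) = 0

/-- `k(z) = (z + q₀² / z) / 2`. -/
def k (q₀ z : ℝ) : ℝ := (z + q₀ ^ 2 / z) / 2

/-- `λ(z) = (z - q₀² / z) / 2`. -/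
def lam (q₀ z : ℝ) : ℝ := (z - q₀ ^ 2 / z) / 2

/-- `ρ̂(z) = z² / (z² - q₀²)`. -/
def rho (q₀ z : ℝ) : ℝ := z ^ 2 / (z ^ 2 - q₀ ^ 2)

/-- The matrix `J = diag(1, -1, -1)`. -/
def J : Matrix (Fin 3) (Fin 3) ℂ := Matrix.diagonal ![1, -1, -1]

/-- The matrix `Q` with blocks `0`, `-v†`, `v`, `0`. -/
def Q (v : EuclideanSpace ℂ (Fin 2)) : Matrix (Fin 3) (Fin 3) ℂ :=
  !![0, -star (v 0), -star (v 1);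
     v 0, 0, 0;
     v 1, 0, 0]

/-- The matrix `X = i k J + i Q` of the scattering problem `ψ_x = X ψ`. -/
def X (q₀ z : ℝ) (v : EuclideanSpace ℂ (Fin 2)) : Matrix (Fin 3) (Fin 3) ℂ :=
  (I * (k q₀ z : ℂ)) • J + I • Q v

/-- The orthogonal vector `v^⊥ = (v₂, -v₁)†`. -/
def perp (v : EuclideanSpace ℂ (Fin 2)) : EuclideanSpace ℂ (Fin 2) :=
  !₂[star (v 1), -star (v 0)]

/-- The eigenvector matrix `Ŷ(z)` of the limit problem with boundary value `v`; its columns are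
`ρ̂ (i, i v / z)`, `(0, v^⊥ / q₀)` and `ρ̂ (q₀ / z, v / q₀)`. -/
def Y (q₀ z : ℝ) (v : EuclideanSpace ℂ (Fin 2)) : Matrix (Fin 3) (Fin 3) ℂ :=
  !![rho q₀ z * I, 0, rho q₀ z * (q₀ / z);
     rho q₀ z * (I * v 0 / z), perp v 0 / q₀, rho q₀ z * (v 0 / q₀);
     rho q₀ z * (I * v 1 / z), perp v 1 / q₀, rho q₀ z * (v 1 / q₀)]

/-- The phase `δ₁ = λ x + 2 λ (k + σ (3 k² - λ²)) t`. -/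
def delta₁ (σ q₀ z x t : ℝ) : ℝ :=
  lam q₀ z * x + 2 * lam q₀ z * (k q₀ z + σ * (3 * k q₀ z ^ 2 - lam q₀ z ^ 2)) * t

/-- The phase `δ₂ = -k x - (λ² + k² + 4 σ k³) t`. -/
def delta₂ (σ q₀ z x t : ℝ) : ℝ :=
  -(k q₀ z * x) - (lam q₀ z ^ 2 + k q₀ z ^ 2 + 4 * σ * k q₀ z ^ 3) * t

/-- The matrix `e^{iΔ}` with `Δ = diag(δ₁, δ₂, -δ₁)`. -/
def expIDelta (σ q₀ z x t : ℝ) : Matrix (Fin 3) (Fin 3) ℂ :=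
  Matrix.diagonal ![exp (I * (delta₁ σ q₀ z x t : ℂ)), exp (I * (delta₂ σ q₀ z x t : ℂ)),
    exp (-(I * (delta₁ σ q₀ z x t : ℂ)))]

/-- `ψ` is, at time `t` and spectral parameter `z`, a Jost solution for the boundary value `v`:
it solves `ψ_x = X ψ` on the line and `ψ = Ŷ e^{iΔ} + o(1)` along `l`, where `l` is `atBot`
(for `ψ₋`, with `v = q₋`) or `atTop` (for `ψ₊`, with `v = q₊`). The derivative is taken
entry by entry. -/
structure IsJost (σ q₀ : ℝ) (q : ℝ → ℝ → EuclideanSpace ℂ (Fin 2)) (t z : ℝ)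
    (l : Filter ℝ) (v : EuclideanSpace ℂ (Fin 2)) (ψ : ℝ → Matrix (Fin 3) (Fin 3) ℂ) : Prop where
  hasDerivAt : ∀ x i j, HasDerivAt (fun y => ψ y i j) ((X q₀ z (q x t) * ψ x) i j) x
  tendsto : Tendsto (fun x => ψ x - Y q₀ z v * expIDelta σ q₀ z x t) l (𝓝 0)

/-- `H` is the scattering matrix at time `t` and spectral parameter `z`: `ψ₊ = ψ₋ H`. -/
def IsScatteringMatrix (σ q₀ : ℝ) (qm qp : EuclideanSpace ℂ (Fin 2))
    (q : ℝ → ℝ → EuclideanSpace ℂ (Fin 2)) (t z : ℝ) (H : Matrix (Fin 3) (Fin 3) ℂ) : Prop :=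
  ∃ ψm ψp : ℝ → Matrix (Fin 3) (Fin 3) ℂ,
    IsJost σ q₀ q t z atBot qm ψm ∧ IsJost σ q₀ q t z atTop qp ψp ∧ ∀ x, ψp x = ψm x * H

/-- The reflection coefficient `β₁ = s₁₃ / s₁₁`, where `S = H⁻¹`. -/
def beta₁ (H : Matrix (Fin 3) (Fin 3) ℂ) : ℂ := H⁻¹ 0 2 / H⁻¹ 0 0

/-- The reflection coefficient `β₂ = h₂₁ / h₁₁`. -/
def beta₂ (H : Matrix (Fin 3) (Fin 3) ℂ) : ℂ := H 1 0 / H 0 0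

/-- The reflection coefficients of the scattering matrix `H` are defined and both vanish. At a
zero of `h₁₁` at least one of them is infinite, since the first column of `H` is not zero, so
such a point does not count as a point of vanishing reflection. -/
structure ReflectionVanishes (H : Matrix (Fin 3) (Fin 3) ℂ) : Prop where
  s₁₁_ne_zero : H⁻¹ 0 0 ≠ 0
  h₁₁_ne_zero : H 0 0 ≠ 0
  beta₁_eq_zero : beta₁ H = 0
  beta₂_eq_zero : beta₂ H = 0

end CoupledHirota

end

noncomputable section

namespace CoupledHirota

/-! The contradiction comes from the limit `z → 0+` at one fixed time. Vanishing `β₂` kills `h₂₁`.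
Since `H` preserves the indefinite form `diag(ρ̂, -1, -ρ̂)`, vanishing `β₁` kills `h₃₁` and then
`|h₁₁| = 1`. So for every small `z` some solution is asymptotic to `e^{iλx}(z, q₊)` on the right and
to `h e^{iλx}(z, q₋)` on the left, with `|h| = 1` (`exists_transparent_solution`).

Multiply it by `e^{-iλx}`. The last two components `u` then satisfy `u' = i q u₀ - i z u`, because
`k + λ = z`. The first component `u₀` rotates at the frequency `k - λ = q₀²/z`, so after one
integration by parts its contribution to `u` is `O(z)`. Hence `u` is constant up to `O(z)` on any
fixed interval (`norm_slow_sub_le`). Outside a large interval the `L¹` tails of `q - q±` keep the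
solution near its plane wave, uniformly in small `z` (`eventually_norm_sub_planeWave_le`). Together
`‖q₊ - h q₋‖` is arbitrarily small for suitable unimodular `h` (`exists_norm_sub_le`), which
non-parallel boundary values exclude.

Existence and uniqueness of `H` rest on the same tail estimates, applied to the amplitudes in the
eigenbasis of the limit problem. -/

/-! ### Linear systems with bounded continuous coefficients -/

/-- The terms of the Dyson series of the system `y' = A y` with initial value `c` at `0`. -/
def dyson {n : ℕ} (A : ℝ → Matrix (Fin n) (Fin n) ℂ) (c : Fin n → ℂ) : ℕ → ℝ → Fin n → ℂ
  | 0 => fun _ => c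
  | m + 1 => fun x => ∫ s in (0 : ℝ)..x, (A s).mulVec (dyson A c m s)

lemma continuous_dyson {n : ℕ} {A : ℝ → Matrix (Fin n) (Fin n) ℂ} (hA : Continuous A)
    (c : Fin n → ℂ) (m : ℕ) : Continuous (dyson A c m) := by
  induction m with
  | zero => exact continuous_const
  | succ m ih =>
    exact intervalIntegral.continuous_primitive
      (fun a b => (hA.matrix_mulVec ih).intervalIntegrable a b) 0

lemma hasDerivAt_dyson_succ {n : ℕ} {A : ℝ → Matrix (Fin n) (Fin n) ℂ} (hA : Continuous A)
    (c : Fin n → ℂ) (m : ℕ) (x : ℝ) :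
    HasDerivAt (dyson A c (m + 1)) ((A x).mulVec (dyson A c m x)) x :=
  have h := hA.matrix_mulVec (continuous_dyson hA c m)
  intervalIntegral.integral_hasDerivAt_right (h.intervalIntegrable 0 x)
    (h.stronglyMeasurableAtFilter _ _) h.continuousAt

/-- Each integration of `|s|^m` gains a factor `|x| / (m + 1)`, which builds up the factorial. The
integral over `Set.uIoc 0 x` treats both signs of `x` at once. -/
lemma norm_dyson_le {n : ℕ} {A : ℝ → Matrix (Fin n) (Fin n) ℂ} {K : ℝ}
    (hK : 0 ≤ K) (hAK : ∀ x v, ‖(A x).mulVec v‖ ≤ K * ‖v‖) (c : Fin n → ℂ) (m : ℕ) (x : ℝ) :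
    ‖dyson A c m x‖ ≤ ‖c‖ * ((K * |x|) ^ m / m.factorial) := by
  induction m generalizing x with
  | zero => simp [dyson]
  | succ m ih =>
    have hi : IntegrableOn (fun s : ℝ => K * (‖c‖ * ((K * |s|) ^ m / m.factorial)))
        (Set.uIoc 0 x) := by
      rw [← intervalIntegrable_iff]
      exact Continuous.intervalIntegrable (by fun_prop) _ _
    calc ‖dyson A c (m + 1) x‖
        ≤ ∫ s in Set.uIoc 0 x, K * (‖c‖ * ((K * |s|) ^ m / m.factorial)) := by
          refine intervalIntegral.norm_intervalIntegral_eq _ _ _ _ |>.trans_le ?_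
          refine norm_integral_le_of_norm_le hi (ae_of_all _ fun s => ?_)
          exact (hAK s _).trans (mul_le_mul_of_nonneg_left (ih s) hK)
      _ = ‖c‖ * ((K * |x|) ^ (m + 1) / (m + 1).factorial) := by
          have h1 : ∀ s : ℝ, K * (‖c‖ * ((K * |s|) ^ m / m.factorial))
              = (K ^ (m + 1) * ‖c‖ / m.factorial) * |s - 0| ^ m := by
            intro s; rw [sub_zero, mul_pow]; ring
          simp_rw [h1]
          rw [integral_const_mul, integral_pow_abs_sub_uIoc, Nat.factorial_succ, sub_zero]
          have := Nat.factorial_ne_zero m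
          push_cast
          field_simp
          ring

/-- Global existence for a linear system with bounded continuous coefficients. -/
theorem exists_linear_solution {n : ℕ} {A : ℝ → Matrix (Fin n) (Fin n) ℂ} (hA : Continuous A)
    {K : ℝ} (hK : 0 ≤ K) (hAK : ∀ x v, ‖(A x).mulVec v‖ ≤ K * ‖v‖) (c : Fin n → ℂ) :
    ∃ y : ℝ → Fin n → ℂ, y 0 = c ∧ ∀ x, HasDerivAt y ((A x).mulVec (y x)) x := by
  have hsum : ∀ x, Summable fun m => dyson A c m x := fun x =>
    Summable.of_norm_bounded ((Real.summable_pow_div_factorial (K * |x|)).mul_left ‖c‖)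
      fun m => norm_dyson_le hK hAK c m x
  have hzero : ∀ m, dyson A c (m + 1) 0 = 0 := fun m => by simp [dyson]
  -- The constant zeroth term is split off because the derivative of the `(m + 1)`-st term is `A`
  -- times the `m`-th: differentiating the shifted series returns the full one.
  have hsplit : ∀ x, ∑' m, dyson A c m x = c + ∑' m, dyson A c (m + 1) x := fun x =>
    (hsum x).tsum_eq_zero_add
  refine ⟨fun x => ∑' m, dyson A c m x, by simp [hsplit, hzero], fun x => ?_⟩
  have hu : Summable fun m : ℕ => K * (‖c‖ * ((K * (|x| + 1)) ^ m / m.factorial)) :=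
    ((Real.summable_pow_div_factorial _).mul_left ‖c‖).mul_left K
  have hball : ∀ m, ∀ y ∈ Metric.ball (0 : ℝ) (|x| + 1),
      ‖(A y).mulVec (dyson A c m y)‖ ≤ K * (‖c‖ * ((K * (|x| + 1)) ^ m / m.factorial)) := by
    intro m y hy
    refine (hAK y _).trans (mul_le_mul_of_nonneg_left ((norm_dyson_le hK hAK c m y).trans ?_) hK)
    have : |y| ≤ |x| + 1 := by simpa using (Metric.mem_ball.1 hy).le
    gcongr
  have hs0 : Summable fun m => dyson A c (m + 1) 0 := by simp only [hzero, summable_zero]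
  have hd : HasDerivAt (fun x => ∑' m, dyson A c (m + 1) x)
      (∑' m, (A x).mulVec (dyson A c m x)) x := by
    exact hasDerivAt_tsum_of_isPreconnected hu Metric.isOpen_ball
      (convex_ball _ _).isPreconnected (fun m y _ => hasDerivAt_dyson_succ hA c m y)
      hball (Metric.mem_ball_self (by positivity)) hs0 (by simp)
  have hA' : (A x).mulVec (∑' m, dyson A c m x) = ∑' m, (A x).mulVec (dyson A c m x) :=
    (LinearMap.toContinuousLinearMap (A x).mulVecLin).map_tsum (hsum x)
  simp only [hsplit] at hA' ⊢
  rw [hA']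
  exact hd.const_add c

theorem linear_solution_unique {n : ℕ} {A : ℝ → Matrix (Fin n) (Fin n) ℂ} {K : ℝ}
    (hAK : ∀ x v, ‖(A x).mulVec v‖ ≤ K * ‖v‖) {y w : ℝ → Fin n → ℂ}
    (hy : ∀ x, HasDerivAt y ((A x).mulVec (y x)) x)
    (hw : ∀ x, HasDerivAt w ((A x).mulVec (w x)) x) {x₀ : ℝ} (h : y x₀ = w x₀) : y = w := by
  refine ODE_solution_unique_univ (K := K.toNNReal) (s := fun _ => Set.univ)
    (v := fun x v => (A x).mulVec v)
    (fun x => (LipschitzWith.of_dist_le_mul fun u v => ?_).lipschitzOnWith)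
    (fun x => ⟨hy x, trivial⟩) (fun x => ⟨hw x, trivial⟩) h
  rw [dist_eq_norm, dist_eq_norm, ← Matrix.mulVec_sub]
  exact (hAK x _).trans (mul_le_mul_of_nonneg_right (Real.le_coe_toNNReal K) (norm_nonneg _))

lemma norm_mulVec_le_of_entry_le {M : Matrix (Fin 3) (Fin 3) ℂ} {m : ℝ} (hm : 0 ≤ m)
    (hM : ∀ i j, ‖M i j‖ ≤ m) (v : Fin 3 → ℂ) : ‖M.mulVec v‖ ≤ 3 * m * ‖v‖ := by
  rw [pi_norm_le_iff_of_nonneg (by positivity)]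
  intro i
  calc ‖M.mulVec v i‖ ≤ ∑ j, ‖M i j * v j‖ := norm_sum_le Finset.univ fun j => M i j * v j
    _ ≤ ∑ _j : Fin 3, m * ‖v‖ := Finset.sum_le_sum fun j _ => by
        rw [norm_mul]; exact mul_le_mul (hM i j) (norm_le_pi_norm v j) (norm_nonneg _) hm
    _ = 3 * m * ‖v‖ := by simp; ring

/-! ### Behaviour at infinity of functions with `‖g'‖ ≤ b' ‖g‖` and `b` bounded -/

section Tail

variable {E : Type*} [NormedAddCommGroup E] [NormedSpace ℝ E] {g g' : ℝ → E} {b β : ℝ → ℝ}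

/-- The mean value inequality with comparison function `M * (b s - b y)`. Working with a primitive
`b` of the rate `β` replaces integrals of `β` by increments of `b`. -/
lemma norm_sub_le_of_norm_deriv_le_mul (hg : ∀ x, HasDerivAt g (g' x) x)
    (hb : ∀ x, HasDerivAt b (β x) x) (hβ : ∀ x, 0 ≤ β x) (hgb : ∀ x, ‖g' x‖ ≤ β x * ‖g x‖)
    {y x M : ℝ} (hyx : y ≤ x) (hM : ∀ s ∈ Set.Icc y x, ‖g s‖ ≤ M) :
    ‖g x - g y‖ ≤ M * (b x - b y) := by
  refine image_norm_le_of_norm_deriv_right_le_deriv_boundary (f := fun s => g s - g y)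
    (f' := g') (B := fun s => M * (b s - b y)) (B' := fun s => M * β s) (a := y) (b := x)
    (fun s _ => ((hg s).sub_const _).continuousAt.continuousWithinAt)
    (fun s _ => ((hg s).sub_const _).hasDerivWithinAt) (by simp)
    (fun s => ((hb s).sub_const _).const_mul M) (fun s hs => ?_) ⟨hyx, le_rfl⟩
  rw [mul_comm]
  exact (hgb s).trans (mul_le_mul_of_nonneg_left (hM s ⟨hs.1, hs.2.le⟩) (hβ s))

/-- Absorption argument: where `‖g‖` is largest on `[R, x]`, it is at most `‖g R‖` plus half of
itself. -/
lemma norm_le_two_mul_of_tail (hg : ∀ x, HasDerivAt g (g' x) x)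
    (hb : ∀ x, HasDerivAt b (β x) x) (hβ : ∀ x, 0 ≤ β x) (hgb : ∀ x, ‖g' x‖ ≤ β x * ‖g x‖)
    {R ε : ℝ} (hε : ε ≤ 1 / 2) (htail : ∀ x, R ≤ x → b x - b R ≤ ε) {x : ℝ} (hx : R ≤ x) :
    ‖g x‖ ≤ 2 * ‖g R‖ := by
  have hc : Continuous g := continuous_iff_continuousAt.2 fun x => (hg x).continuousAt
  obtain ⟨p, hp, hmax⟩ := isCompact_Icc.exists_isMaxOn (Set.nonempty_Icc.2 hx)
    hc.norm.continuousOn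
  have h1 := norm_sub_le_of_norm_deriv_le_mul hg hb hβ hgb hp.1
    (M := ‖g p‖) (fun s hs => hmax ⟨hs.1, hs.2.trans hp.2⟩)
  have h2 : ‖g p‖ * (b p - b R) ≤ ‖g p‖ * (1 / 2) :=
    mul_le_mul_of_nonneg_left ((htail p hp.1).trans hε) (norm_nonneg _)
  have h3 := norm_sub_norm_le (g p) (g R)
  have h4 : ‖g x‖ ≤ ‖g p‖ := hmax ⟨hx, le_rfl⟩
  linarith

/-- Letting `x → ∞` gives `‖g R - ℓ‖ ≤ 2 ε ‖g R‖`, and `ε ≤ 1/4` then gives `‖g R‖ ≤ 2 ‖ℓ‖`. An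
error relative to `ℓ` is what makes a zero limit force `g R = 0`. -/
lemma norm_sub_le_of_tail (hg : ∀ x, HasDerivAt g (g' x) x)
    (hb : ∀ x, HasDerivAt b (β x) x) (hβ : ∀ x, 0 ≤ β x) (hgb : ∀ x, ‖g' x‖ ≤ β x * ‖g x‖)
    {R ε : ℝ} (hε : ε ≤ 1 / 4) (htail : ∀ x, R ≤ x → b x - b R ≤ ε) {ℓ : E}
    (hℓ : Tendsto g atTop (𝓝 ℓ)) : ‖g R - ℓ‖ ≤ 4 * ε * ‖ℓ‖ := by
  have hε0 : 0 ≤ ε := by simpa using htail R le_rfl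
  have h1 : ‖ℓ - g R‖ ≤ 2 * ‖g R‖ * ε := by
    refine le_of_tendsto (hℓ.sub_const _).norm ((eventually_ge_atTop R).mono fun x hx => ?_)
    exact (norm_sub_le_of_norm_deriv_le_mul hg hb hβ hgb hx fun s hs =>
      norm_le_two_mul_of_tail hg hb hβ hgb (hε.trans (by norm_num)) htail hs.1).trans
      (mul_le_mul_of_nonneg_left (htail x hx) (by positivity))
  rw [norm_sub_rev] at h1
  have h2 : ‖g R‖ - ‖ℓ‖ ≤ ‖g R - ℓ‖ := norm_sub_norm_le _ _
  have h3 : ‖g R‖ * ε ≤ ‖g R‖ * (1 / 4) := mul_le_mul_of_nonneg_left hε (norm_nonneg _)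
  have h4 : ‖g R‖ * ε ≤ 2 * ‖ℓ‖ * ε := mul_le_mul_of_nonneg_right (by linarith) hε0
  linarith

/-- Beyond a suitable `R`, `g` is bounded by `2 ‖g R‖`, so its increments are dominated by those of
the convergent `b` and `g` is Cauchy. -/
lemma exists_tendsto_of_tail [CompleteSpace E] (hg : ∀ x, HasDerivAt g (g' x) x)
    (hb : ∀ x, HasDerivAt b (β x) x) (hβ : ∀ x, 0 ≤ β x) (hgb : ∀ x, ‖g' x‖ ≤ β x * ‖g x‖)
    {B : ℝ} (hB : Tendsto b atTop (𝓝 B)) : ∃ ℓ, Tendsto g atTop (𝓝 ℓ) := by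
  have hmono : Monotone b := monotone_of_hasDerivAt_nonneg hb hβ
  have hle : ∀ x, b x ≤ B := fun x => hmono.ge_of_tendsto hB x
  have hBR : ∀ ε > 0, ∃ R, ∀ x, R ≤ x → B - b x < ε := fun ε hε => by
    obtain ⟨R, hR⟩ := eventually_atTop.1 (hB.eventually_const_lt (sub_lt_self B hε))
    exact ⟨R, fun x hx => by linarith [hR x hx]⟩
  obtain ⟨R, hR⟩ := hBR (1 / 2) (by norm_num)
  have htail : ∀ x, R ≤ x → b x - b R ≤ 1 / 2 := fun x _ => by
    linarith [hle x, hR R le_rfl]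
  refine cauchySeq_tendsto_of_complete (Metric.cauchySeq_iff'.2 fun ε hε => ?_)
  obtain ⟨S, hS⟩ := hBR (ε / (2 * ‖g R‖ + 1)) (by positivity)
  refine ⟨max R S, fun x hx => ?_⟩
  rw [dist_eq_norm]
  have h1 := norm_sub_le_of_norm_deriv_le_mul hg hb hβ hgb hx fun s hs =>
    norm_le_two_mul_of_tail hg hb hβ hgb le_rfl htail ((le_max_left R S).trans hs.1)
  have h2 : b x - b (max R S) < ε / (2 * ‖g R‖ + 1) := by
    linarith [hle x, hS _ (le_max_right R S)]
  rw [lt_div_iff₀ (by positivity)] at h2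
  have h3 := hmono hx
  nlinarith [norm_nonneg (g R)]

end Tail

/-! ### Tails of potentials tending to a constant in `L¹` -/

/-- Along `l`, the potential `q` is so close to `v` that functions whose derivative is controlled
by `‖q - v‖` converge, with a quantitative estimate. -/
structure ControlsTail (l : Filter ℝ) (q : ℝ → EuclideanSpace ℂ (Fin 2))
    (v : EuclideanSpace ℂ (Fin 2)) : Prop where
  exists_tendsto : ∀ (C : ℝ) (g g' : ℝ → Fin 3 → ℂ), 0 ≤ C → (∀ x, HasDerivAt g (g' x) x) →
    (∀ x, ‖g' x‖ ≤ C * ‖q x - v‖ * ‖g x‖) → ∃ ℓ, Tendsto g l (𝓝 ℓ)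
  -- The point `R` is chosen from `ε` alone, before `C` and `g`. This uniformity later lets a single
  -- `R` serve all small `z`.
  norm_sub_le : ∀ ε > 0, ∀ᶠ R in l, ∀ (C : ℝ) (g g' : ℝ → Fin 3 → ℂ) (ℓ : Fin 3 → ℂ), 0 ≤ C →
    C * ε ≤ 1 / 4 → (∀ x, HasDerivAt g (g' x) x) → (∀ x, ‖g' x‖ ≤ C * ‖q x - v‖ * ‖g x‖) →
    Tendsto g l (𝓝 ℓ) → ‖g R - ℓ‖ ≤ 4 * (C * ε) * ‖ℓ‖

/-- The primitive of `‖q - v‖` converges at infinity by integrability, and `C` times it is the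
function `b` of the tail estimates. -/
lemma controlsTail_atTop {q : ℝ → EuclideanSpace ℂ (Fin 2)} (hq : Continuous q)
    {v : EuclideanSpace ℂ (Fin 2)} (hint : IntegrableOn (fun x => q x - v) (Set.Ioi 0)) :
    ControlsTail atTop q v := by
  have hc : Continuous fun x => ‖q x - v‖ := (hq.sub continuous_const).norm
  set b : ℝ → ℝ := fun x => ∫ s in (0 : ℝ)..x, ‖q s - v‖ with hbdef
  have hb : ∀ x, HasDerivAt b ‖q x - v‖ x := fun x =>
    intervalIntegral.integral_hasDerivAt_right (hc.intervalIntegrable 0 x)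
      (hc.stronglyMeasurableAtFilter _ _) hc.continuousAt
  have hB := intervalIntegral_tendsto_integral_Ioi 0 hint.norm tendsto_id
  refine ⟨fun C g g' hC hg hgb => ?_, fun ε hε => ?_⟩
  · exact exists_tendsto_of_tail hg (fun x => (hb x).const_mul C) (fun x => by positivity) hgb
      (hB.const_mul C)
  · have hmono : Monotone b := monotone_of_hasDerivAt_nonneg hb fun x => norm_nonneg _
    filter_upwards [hB.eventually_const_lt (sub_lt_self _ hε)] with R hR C g g' ℓ hC hCε hg hgb hℓ
    refine norm_sub_le_of_tail hg (fun x => (hb x).const_mul C) (fun x => by positivity) hgb hCε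
      (fun x _ => ?_) hℓ
    rw [← mul_sub]
    have h1 : b x ≤ _ := hmono.ge_of_tendsto hB x
    exact mul_le_mul_of_nonneg_left (by simp only [id] at hR; linarith) hC

lemma ControlsTail.comp_neg {q : ℝ → EuclideanSpace ℂ (Fin 2)} {v : EuclideanSpace ℂ (Fin 2)}
    (h : ControlsTail atTop (fun x => q (-x)) v) : ControlsTail atBot q v := by
  have hneg : ∀ {g g' : ℝ → Fin 3 → ℂ}, (∀ x, HasDerivAt g (g' x) x) →
      ∀ x, HasDerivAt (fun x => g (-x)) (-g' (-x)) x := fun hg x => by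
    simpa only [neg_smul, one_smul] using! (hg (-x)).scomp x (hasDerivAt_neg x)
  refine ⟨fun C g g' hC hg hgb => ?_, fun ε hε => ?_⟩
  · obtain ⟨ℓ, hℓ⟩ := h.exists_tendsto C _ _ hC (hneg hg)
      (fun x => by rw [norm_neg]; exact hgb (-x))
    exact ⟨ℓ, by simpa [Function.comp_def] using hℓ.comp tendsto_neg_atBot_atTop⟩
  · filter_upwards [tendsto_neg_atBot_atTop.eventually (h.norm_sub_le ε hε)]
      with R hR C g g' ℓ hC hCε hg hgb hℓ
    simpa using hR C _ _ ℓ hC hCε (hneg hg) (fun x => by rw [norm_neg]; exact hgb (-x))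
      (hℓ.comp tendsto_neg_atTop_atBot)

lemma controlsTail_atBot {q : ℝ → EuclideanSpace ℂ (Fin 2)} (hq : Continuous q)
    {v : EuclideanSpace ℂ (Fin 2)} (hint : IntegrableOn (fun x => q x - v) (Set.Iio 0)) :
    ControlsTail atBot q v := by
  refine ControlsTail.comp_neg (controlsTail_atTop (hq.comp continuous_neg) ?_)
  have h := (Measure.measurePreserving_neg (volume : Measure ℝ)).integrableOn_comp_preimage
    (MeasurableEquiv.neg ℝ).measurableEmbedding (f := fun x => q x - v) (s := Set.Iio 0)
  have h' := h.2 hint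
  simpa [Function.comp_def] using h'

/-! ### Eigenvectors of the limit problem -/

/-- Eigenvectors of `X q₀ z v`, normalized so that they stay bounded and independent as
`z → 0`. -/
def eigenbasis (q₀ z : ℝ) (v : EuclideanSpace ℂ (Fin 2)) : Matrix (Fin 3) (Fin 3) ℂ :=
  !![(z : ℂ), 0, q₀;
     v 0, perp v 0, z * v 0 / q₀;
     v 1, perp v 1, z * v 1 / q₀]

/-- The inverse of `eigenbasis q₀ z v`. -/
def eigenbasisInv (q₀ z : ℝ) (v : EuclideanSpace ℂ (Fin 2)) : Matrix (Fin 3) (Fin 3) ℂ :=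
  !![z / (z ^ 2 - q₀ ^ 2 : ℂ), -star (v 0) / (z ^ 2 - q₀ ^ 2 : ℂ), -star (v 1) / (z ^ 2 - q₀ ^ 2 : ℂ);
     0, v 1 / (q₀ ^ 2 : ℂ), -v 0 / (q₀ ^ 2 : ℂ);
     -q₀ / (z ^ 2 - q₀ ^ 2 : ℂ), z * star (v 0) / q₀ / (z ^ 2 - q₀ ^ 2 : ℂ),
       z * star (v 1) / q₀ / (z ^ 2 - q₀ ^ 2 : ℂ)]

/-- The eigenvalues of `X q₀ z v` divided by `i`. -/
def freq (q₀ z : ℝ) : Fin 3 → ℝ := ![lam q₀ z, -k q₀ z, -lam q₀ z]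

/-- The values of the form `u ↦ u† J u` on the columns of `eigenbasis`. -/
def eigenNorm (q₀ z : ℝ) : Fin 3 → ℂ :=
  ![(z ^ 2 - q₀ ^ 2 : ℂ), -(q₀ ^ 2 : ℂ), (q₀ ^ 2 - z ^ 2 : ℂ)]

section Algebra

variable {q₀ z : ℝ} {v : EuclideanSpace ℂ (Fin 2)}

lemma conj_mul_add_conj_mul (hv : ‖v‖ = q₀) {a b : ℂ} (ha : v 0 = a) (hb : v 1 = b) :
    (starRingEnd ℂ) a * a + (starRingEnd ℂ) b * b = (q₀ ^ 2 : ℂ) := by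
  have h : ‖a‖ ^ 2 + ‖b‖ ^ 2 = q₀ ^ 2 := by
    rw [← hv, EuclideanSpace.norm_sq_eq, Fin.sum_univ_two, ha, hb]
  have h0 : ∀ w : ℂ, (starRingEnd ℂ) w * w = ((‖w‖ ^ 2 : ℝ) : ℂ) := fun w => by
    rw [← Complex.normSq_eq_norm_sq, Complex.normSq_eq_conj_mul_self]
  rw [h0, h0, ← ofReal_add, h, ofReal_pow]

lemma J_eq : J = !![1, 0, 0; 0, -1, 0; 0, 0, -1] := by
  ext i j
  fin_cases i <;> fin_cases j <;> simp [J]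

lemma X_eq (w : EuclideanSpace ℂ (Fin 2)) : X q₀ z w =
    !![I * k q₀ z, -(I * star (w 0)), -(I * star (w 1));
       I * w 0, -(I * k q₀ z), 0;
       I * w 1, 0, -(I * k q₀ z)] := by
  ext i j
  fin_cases i <;> fin_cases j <;> simp [X, Q, J_eq]

lemma sq_sub_sq_ne_zero (h1 : z ≠ q₀) (h2 : z ≠ -q₀) : (z ^ 2 - q₀ ^ 2 : ℂ) ≠ 0 := by
  have : z ^ 2 - q₀ ^ 2 ≠ 0 := by
    rw [sq_sub_sq]
    exact mul_ne_zero (fun h => h2 (by linarith)) (sub_ne_zero.2 h1)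
  exact_mod_cast this

/-- The first and third columns rely on `k + λ = z`, `k - λ = q₀²/z` and `‖v‖ = q₀`. -/
lemma X_mul_eigenbasis (hq₀ : 0 < q₀) (hv : ‖v‖ = q₀) (hz : z ≠ 0) :
    X q₀ z v * eigenbasis q₀ z v =
      eigenbasis q₀ z v * Matrix.diagonal (fun j => I * (freq q₀ z j : ℂ)) := by
  have hv' := conj_mul_add_conj_mul hv rfl rfl
  have hz' : (z : ℂ) ≠ 0 := by exact_mod_cast hz
  have hq' : (q₀ : ℂ) ≠ 0 := by exact_mod_cast hq₀.ne'
  have hk : (k q₀ z : ℂ) = (z + q₀ ^ 2 / z) / 2 := by simp [k]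
  have hl : (lam q₀ z : ℂ) = (z - q₀ ^ 2 / z) / 2 := by simp [lam]
  ext i j
  fin_cases i <;> fin_cases j <;>
    simp [X_eq, eigenbasis, freq, Matrix.mul_apply, Fin.sum_univ_three, Matrix.diagonal, perp,
      hk, hl] <;> field_simp <;> grind

lemma eigenbasisInv_mul (hq₀ : 0 < q₀) (hv : ‖v‖ = q₀) (h1 : z ≠ q₀) (h2 : z ≠ -q₀) :
    eigenbasisInv q₀ z v * eigenbasis q₀ z v = 1 := by
  have hv' := conj_mul_add_conj_mul hv rfl rfl
  have hz' := sq_sub_sq_ne_zero h1 h2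
  have hq' : (q₀ : ℂ) ≠ 0 := by exact_mod_cast hq₀.ne'
  ext i j
  fin_cases i <;> fin_cases j <;>
    simp [eigenbasis, eigenbasisInv, Matrix.mul_apply, Fin.sum_univ_three, perp] <;>
    field_simp <;> grind

lemma eigenbasis_mul_inv (hq₀ : 0 < q₀) (hv : ‖v‖ = q₀) (h1 : z ≠ q₀) (h2 : z ≠ -q₀) :
    eigenbasis q₀ z v * eigenbasisInv q₀ z v = 1 :=
  mul_eq_one_comm.1 (eigenbasisInv_mul hq₀ hv h1 h2)

lemma eigenbasisInv_mul_X (hq₀ : 0 < q₀) (hv : ‖v‖ = q₀) (hz : z ≠ 0) (h1 : z ≠ q₀)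
    (h2 : z ≠ -q₀) : eigenbasisInv q₀ z v * X q₀ z v =
      Matrix.diagonal (fun j => I * (freq q₀ z j : ℂ)) * eigenbasisInv q₀ z v := by
  have h := congrArg (fun M => eigenbasisInv q₀ z v * M * eigenbasisInv q₀ z v)
    (X_mul_eigenbasis hq₀ hv hz)
  simp only [← Matrix.mul_assoc, eigenbasisInv_mul hq₀ hv h1 h2, Matrix.one_mul] at h
  rwa [Matrix.mul_assoc (eigenbasisInv q₀ z v * X q₀ z v), eigenbasis_mul_inv hq₀ hv h1 h2,
    Matrix.mul_one] at h

/-- The eigenvectors are orthogonal for the indefinite form of `J`, so that form becomes diagonal in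
the amplitudes. -/
lemma eigenbasis_conjTranspose_mul (hq₀ : 0 < q₀) (hv : ‖v‖ = q₀) :
    (eigenbasis q₀ z v).conjTranspose * J * eigenbasis q₀ z v =
      Matrix.diagonal (eigenNorm q₀ z) := by
  have hv' := conj_mul_add_conj_mul hv rfl rfl
  have hq' : (q₀ : ℂ) ≠ 0 := by exact_mod_cast hq₀.ne'
  ext i j
  fin_cases i <;> fin_cases j <;>
    simp [eigenbasis, J_eq, eigenNorm, Matrix.mul_apply, Fin.sum_univ_three, Matrix.diagonal, perp]
      <;> field_simp <;> grind

/-- The factors between the columns of `Y` and those of `eigenbasis`. -/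
def scale (q₀ z : ℝ) : Fin 3 → ℂ := ![rho q₀ z * I / z, 1 / q₀, rho q₀ z / z]

lemma Y_eq_eigenbasis_mul (hq₀ : 0 < q₀) (hz : z ≠ 0) :
    Y q₀ z v = eigenbasis q₀ z v * Matrix.diagonal (scale q₀ z) := by
  have hz' : (z : ℂ) ≠ 0 := by exact_mod_cast hz
  have hq' : (q₀ : ℂ) ≠ 0 := by exact_mod_cast hq₀.ne'
  ext i j
  fin_cases i <;> fin_cases j <;>
    simp [Y, eigenbasis, scale, perp] <;> field_simp

/-- `i k J` is anti-Hermitian and commutes with `J`, while `i Q` is Hermitian and anticommutes with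
`J`. The identity makes `ψ† J ψ` constant in `x`. -/
lemma X_conjTranspose_mul_J (w : EuclideanSpace ℂ (Fin 2)) :
    (X q₀ z w).conjTranspose * J + J * X q₀ z w = 0 := by
  ext i j
  fin_cases i <;> fin_cases j <;>
    simp [X_eq, J_eq, Matrix.mul_apply, Fin.sum_univ_three]

lemma norm_Q_apply_le (w : EuclideanSpace ℂ (Fin 2)) (i j : Fin 3) : ‖Q w i j‖ ≤ ‖w‖ := by
  have h := PiLp.norm_apply_le w
  fin_cases i <;> fin_cases j <;> simp [Q, h]

lemma X_sub_X (w : EuclideanSpace ℂ (Fin 2)) : X q₀ z w - X q₀ z v = I • Q (w - v) := by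
  ext i j
  fin_cases i <;> fin_cases j <;> simp [X, Q] <;> ring

lemma norm_X_apply_le (w : EuclideanSpace ℂ (Fin 2)) (i j : Fin 3) :
    ‖X q₀ z w i j‖ ≤ |k q₀ z| + ‖w‖ := by
  have h : ‖J i j‖ ≤ 1 := by fin_cases i <;> fin_cases j <;> simp [J]
  calc ‖X q₀ z w i j‖ ≤ ‖I * (k q₀ z : ℂ) * J i j‖ + ‖I * Q w i j‖ := norm_add_le _ _
    _ ≤ |k q₀ z| + ‖w‖ := by
      simp only [norm_mul, norm_I, one_mul, norm_real, Real.norm_eq_abs]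
      exact add_le_add (mul_le_of_le_one_right (abs_nonneg _) h) (norm_Q_apply_le w i j)

lemma continuous_X {q : ℝ → EuclideanSpace ℂ (Fin 2)} (hq : Continuous q) :
    Continuous fun x => X q₀ z (q x) := by
  have h : ∀ i, Continuous fun x => q x i := fun i => by fun_prop
  refine continuous_matrix fun i j => ?_
  fin_cases i <;> fin_cases j <;> simp [X_eq] <;> fun_prop

end Algebra

/-! ### Passing to the eigenbasis of the limit problem -/

/-- The matrix taking solutions of the scattering problem to the slowly varying amplitudes. -/
def gauge (q₀ z : ℝ) (v : EuclideanSpace ℂ (Fin 2)) (x : ℝ) : Matrix (Fin 3) (Fin 3) ℂ :=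
  Matrix.diagonal (fun j => exp (-(I * (freq q₀ z j * x : ℝ)))) * eigenbasisInv q₀ z v

/-- The inverse of `gauge q₀ z v x`. -/
def gaugeInv (q₀ z : ℝ) (v : EuclideanSpace ℂ (Fin 2)) (x : ℝ) : Matrix (Fin 3) (Fin 3) ℂ :=
  eigenbasis q₀ z v * Matrix.diagonal (fun j => exp (I * (freq q₀ z j * x : ℝ)))

lemma norm_exp_I_mul (r : ℝ) : ‖exp (I * r)‖ = 1 := by
  rw [mul_comm]; exact norm_exp_ofReal_mul_I r

lemma norm_exp_neg_I_mul (r : ℝ) : ‖exp (-(I * r))‖ = 1 := by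
  simpa using norm_exp_I_mul (-r)

section Gauge

variable {q₀ z : ℝ} {v : EuclideanSpace ℂ (Fin 2)}

lemma gauge_mul_gaugeInv (hq₀ : 0 < q₀) (hv : ‖v‖ = q₀) (h1 : z ≠ q₀) (h2 : z ≠ -q₀) (x : ℝ) :
    gauge q₀ z v x * gaugeInv q₀ z v x = 1 := by
  rw [gauge, gaugeInv, Matrix.mul_assoc, ← Matrix.mul_assoc (eigenbasisInv q₀ z v),
    eigenbasisInv_mul hq₀ hv h1 h2, Matrix.one_mul, Matrix.diagonal_mul_diagonal]
  simp [← Complex.exp_add]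

lemma gaugeInv_mul_gauge (hq₀ : 0 < q₀) (hv : ‖v‖ = q₀) (h1 : z ≠ q₀) (h2 : z ≠ -q₀) (x : ℝ) :
    gaugeInv q₀ z v x * gauge q₀ z v x = 1 :=
  mul_eq_one_comm.1 (gauge_mul_gaugeInv hq₀ hv h1 h2 x)

lemma norm_gauge_apply (x : ℝ) (i j : Fin 3) :
    ‖gauge q₀ z v x i j‖ = ‖eigenbasisInv q₀ z v i j‖ := by
  rw [gauge, Matrix.diagonal_mul, norm_mul, norm_exp_neg_I_mul, one_mul]

lemma norm_gaugeInv_apply (x : ℝ) (i j : Fin 3) :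
    ‖gaugeInv q₀ z v x i j‖ = ‖eigenbasis q₀ z v i j‖ := by
  rw [gaugeInv, Matrix.mul_diagonal, norm_mul, norm_exp_I_mul, mul_one]

/-- Variation of constants: the exponentials cancel the diagonalized limit problem, so only `X(w) -
X(v)`, of size `‖w - v‖`, drives the amplitudes. -/
lemma hasDerivAt_gauge_mulVec (hq₀ : 0 < q₀) (hv : ‖v‖ = q₀) (hz : z ≠ 0) (h1 : z ≠ q₀)
    (h2 : z ≠ -q₀) {y : ℝ → Fin 3 → ℂ} {w : EuclideanSpace ℂ (Fin 2)} {x : ℝ}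
    (hy : HasDerivAt y ((X q₀ z w).mulVec (y x)) x) :
    HasDerivAt (fun x => (gauge q₀ z v x).mulVec (y x))
      ((gauge q₀ z v x).mulVec ((X q₀ z w - X q₀ z v).mulVec (y x))) x := by
  rw [hasDerivAt_pi]
  intro j
  have hexp : HasDerivAt (fun x : ℝ => exp (-(I * (freq q₀ z j * x : ℝ))))
      (exp (-(I * (freq q₀ z j * x : ℝ))) * -(I * freq q₀ z j)) x := by
    have h : HasDerivAt (fun x : ℝ => -(I * (freq q₀ z j * x : ℝ))) (-(I * freq q₀ z j)) x := by
      have := ((hasDerivAt_id x).const_mul (freq q₀ z j)).ofReal_comp.const_mul I |>.neg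
      simpa using! this
    exact h.cexp
  have hW : HasDerivAt (fun x => (eigenbasisInv q₀ z v).mulVec (y x) j)
      ((eigenbasisInv q₀ z v).mulVec ((X q₀ z w).mulVec (y x)) j) x := by
    have hy' := hasDerivAt_pi.1 hy
    exact HasDerivAt.fun_sum (u := Finset.univ)
      (A := fun i x => eigenbasisInv q₀ z v j i * y x i) fun i _ => (hy' i).const_mul _
  have hX : (eigenbasisInv q₀ z v).mulVec ((X q₀ z v).mulVec (y x)) j =
      I * freq q₀ z j * (eigenbasisInv q₀ z v).mulVec (y x) j := by
    rw [Matrix.mulVec_mulVec, eigenbasisInv_mul_X hq₀ hv hz h1 h2, ← Matrix.mulVec_mulVec,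
      Matrix.mulVec_diagonal]
  have hfun : (fun x => (gauge q₀ z v x).mulVec (y x) j) = fun x =>
      exp (-(I * (freq q₀ z j * x : ℝ))) * (eigenbasisInv q₀ z v).mulVec (y x) j := by
    funext x
    rw [gauge, ← Matrix.mulVec_mulVec, Matrix.mulVec_diagonal]
  rw [hfun]
  refine (hexp.mul hW).congr_deriv ?_
  rw [gauge, ← Matrix.mulVec_mulVec, Matrix.mulVec_diagonal, Matrix.sub_mulVec,
    Matrix.mulVec_sub, Pi.sub_apply, hX]
  ring

/-- Each of the three matrix products costs a factor 3. The phases are unimodular because the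
frequencies are real. The constant is explicit in `m` and `m'` so that it can be bounded uniformly
in `z`. -/
lemma norm_gauge_mulVec_deriv_le (hq₀ : 0 < q₀) (hv : ‖v‖ = q₀) (h1 : z ≠ q₀) (h2 : z ≠ -q₀)
    {m m' : ℝ} (hm : ∀ i j, ‖eigenbasis q₀ z v i j‖ ≤ m)
    (hm' : ∀ i j, ‖eigenbasisInv q₀ z v i j‖ ≤ m') (u : Fin 3 → ℂ)
    (w : EuclideanSpace ℂ (Fin 2)) (x : ℝ) :
    ‖(gauge q₀ z v x).mulVec ((X q₀ z w - X q₀ z v).mulVec u)‖ ≤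
      27 * m * m' * ‖w - v‖ * ‖(gauge q₀ z v x).mulVec u‖ := by
  have hm0 : 0 ≤ m := (norm_nonneg _).trans (hm 0 0)
  have hm0' : 0 ≤ m' := (norm_nonneg _).trans (hm' 0 0)
  have hu : ‖u‖ ≤ 3 * m * ‖(gauge q₀ z v x).mulVec u‖ := by
    have h := norm_mulVec_le_of_entry_le hm0 (M := gaugeInv q₀ z v x)
      (fun i j => (norm_gaugeInv_apply x i j).trans_le (hm i j)) ((gauge q₀ z v x).mulVec u)
    rwa [Matrix.mulVec_mulVec, gaugeInv_mul_gauge hq₀ hv h1 h2, Matrix.one_mulVec] at h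
  have hX : ‖(X q₀ z w - X q₀ z v).mulVec u‖ ≤ 3 * ‖w - v‖ * ‖u‖ := by
    refine norm_mulVec_le_of_entry_le (norm_nonneg _) (fun i j => ?_) u
    rw [X_sub_X, Matrix.smul_apply, norm_smul, norm_I, one_mul]
    exact norm_Q_apply_le _ i j
  calc ‖(gauge q₀ z v x).mulVec ((X q₀ z w - X q₀ z v).mulVec u)‖
      ≤ 3 * m' * ‖(X q₀ z w - X q₀ z v).mulVec u‖ := norm_mulVec_le_of_entry_le hm0'
        (fun i j => (norm_gauge_apply x i j).trans_le (hm' i j)) _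
    _ ≤ 3 * m' * (3 * ‖w - v‖ * (3 * m * ‖(gauge q₀ z v x).mulVec u‖)) := by
        gcongr; exact hX.trans (by gcongr)
    _ = _ := by ring

lemma exists_entry_bound (M : Matrix (Fin 3) (Fin 3) ℂ) : ∃ m, ∀ i j, ‖M i j‖ ≤ m := by
  refine ⟨∑ i, ∑ j, ‖M i j‖, fun i j => ?_⟩
  exact (Finset.single_le_sum (f := fun j => ‖M i j‖) (fun _ _ => norm_nonneg _)
    (Finset.mem_univ j)).trans (Finset.single_le_sum (f := fun i => ∑ j, ‖M i j‖)
    (fun _ _ => Finset.sum_nonneg fun _ _ => norm_nonneg _) (Finset.mem_univ i))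

lemma exists_gauge_bound (hq₀ : 0 < q₀) (hv : ‖v‖ = q₀) (h1 : z ≠ q₀) (h2 : z ≠ -q₀) :
    ∃ C, 0 ≤ C ∧ ∀ (u : Fin 3 → ℂ) (w : EuclideanSpace ℂ (Fin 2)) (x : ℝ),
      ‖(gauge q₀ z v x).mulVec ((X q₀ z w - X q₀ z v).mulVec u)‖ ≤
        C * ‖w - v‖ * ‖(gauge q₀ z v x).mulVec u‖ := by
  obtain ⟨m, hm⟩ := exists_entry_bound (eigenbasis q₀ z v)
  obtain ⟨m', hm'⟩ := exists_entry_bound (eigenbasisInv q₀ z v)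
  have hm0 : 0 ≤ m := (norm_nonneg _).trans (hm 0 0)
  have hm0' : 0 ≤ m' := (norm_nonneg _).trans (hm' 0 0)
  exact ⟨27 * m * m', by positivity, norm_gauge_mulVec_deriv_le hq₀ hv h1 h2 hm hm'⟩

lemma tendsto_matrix_iff {l : Filter ℝ} {M : ℝ → Matrix (Fin 3) (Fin 3) ℂ}
    {L : Matrix (Fin 3) (Fin 3) ℂ} :
    Tendsto M l (𝓝 L) ↔ ∀ i j, Tendsto (fun x => M x i j) l (𝓝 (L i j)) :=
  tendsto_pi_nhds.trans (forall_congr' fun _ => tendsto_pi_nhds)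

lemma tendsto_zero_mul_of_entry_le {l : Filter ℝ} {M N : ℝ → Matrix (Fin 3) (Fin 3) ℂ} {m : ℝ}
    (hM : ∀ x i j, ‖M x i j‖ ≤ m) (hN : Tendsto N l (𝓝 0)) :
    Tendsto (fun x => M x * N x) l (𝓝 0) := by
  rw [tendsto_matrix_iff]
  intro i j
  have hN' : ∀ s, Tendsto (fun x => N x s j) l (𝓝 0) := fun s =>
    tendsto_matrix_iff.1 hN s j
  have h : Tendsto (fun x => ∑ s, M x i s * N x s j) l (𝓝 (∑ _s : Fin 3, (0 : ℂ))) :=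
    tendsto_finsetSum _ fun s _ => by
      refine squeeze_zero_norm (a := fun x => m * ‖N x s j‖) (fun x => ?_)
        (by simpa using (hN' s).norm.const_mul m)
      rw [norm_mul]
      exact mul_le_mul_of_nonneg_right (hM x i s) (norm_nonneg _)
  simpa [Matrix.mul_apply] using! h

end Gauge

/-! ### Jost solutions -/

section Jost

variable {σ q₀ z t : ℝ} {v : EuclideanSpace ℂ (Fin 2)} {l : Filter ℝ}
  {q : ℝ → EuclideanSpace ℂ (Fin 2)}

/-- The time dependent part of the phases, `θ₁, θ₂, -θ₁`. -/
def timePhase (σ q₀ z t : ℝ) : Fin 3 → ℝ :=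
  ![delta₁ σ q₀ z 0 t, delta₂ σ q₀ z 0 t, -delta₁ σ q₀ z 0 t]

/-- The limiting amplitudes of a Jost solution in the eigenbasis. -/
def amplitude (σ q₀ z t : ℝ) (j : Fin 3) : ℂ := scale q₀ z j * exp (I * timePhase σ q₀ z t j)

lemma Y_mul_expIDelta (hq₀ : 0 < q₀) (hz : z ≠ 0) (x : ℝ) :
    Y q₀ z v * expIDelta σ q₀ z x t =
      gaugeInv q₀ z v x * Matrix.diagonal (amplitude σ q₀ z t) := by
  have h : expIDelta σ q₀ z x t = Matrix.diagonal fun j =>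
      exp (I * timePhase σ q₀ z t j) * exp (I * (freq q₀ z j * x : ℝ)) := by
    rw [expIDelta, Matrix.diagonal_eq_diagonal_iff]
    intro j
    rw [← Complex.exp_add]
    fin_cases j <;> simp [timePhase, freq, delta₁, delta₂] <;> ring_nf
  rw [Y_eq_eigenbasis_mul hq₀ hz, gaugeInv, h, Matrix.mul_assoc, Matrix.mul_assoc,
    Matrix.diagonal_mul_diagonal, Matrix.diagonal_mul_diagonal]
  congr 2
  funext j
  simp only [amplitude]
  ring

/-- The gauge and its inverse are bounded in `x`, so an `o(1)` error for `ψ` is the same as an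
`o(1)` error for the amplitudes. -/
lemma tendsto_jost_iff (hq₀ : 0 < q₀) (hv : ‖v‖ = q₀) (hz : z ≠ 0) (h1 : z ≠ q₀)
    (h2 : z ≠ -q₀) {ψ : ℝ → Matrix (Fin 3) (Fin 3) ℂ} :
    Tendsto (fun x => ψ x - Y q₀ z v * expIDelta σ q₀ z x t) l (𝓝 0) ↔
      Tendsto (fun x => gauge q₀ z v x * ψ x) l (𝓝 (Matrix.diagonal (amplitude σ q₀ z t))) := by
  rw [← tendsto_sub_nhds_zero_iff (x := Matrix.diagonal (amplitude σ q₀ z t))]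
  simp only [Y_mul_expIDelta hq₀ hz]
  obtain ⟨m, hm⟩ := exists_entry_bound (eigenbasis q₀ z v)
  obtain ⟨m', hm'⟩ := exists_entry_bound (eigenbasisInv q₀ z v)
  constructor <;> intro h
  · have := tendsto_zero_mul_of_entry_le (M := gauge q₀ z v)
      (fun x i j => (norm_gauge_apply x i j).trans_le (hm' i j)) h
    simpa [Matrix.mul_sub, ← Matrix.mul_assoc, gauge_mul_gaugeInv hq₀ hv h1 h2] using this
  · have := tendsto_zero_mul_of_entry_le (M := gaugeInv q₀ z v)
      (fun x i j => (norm_gaugeInv_apply x i j).trans_le (hm i j)) h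
    simpa [Matrix.mul_sub, ← Matrix.mul_assoc, gaugeInv_mul_gauge hq₀ hv h1 h2] using this

lemma exists_X_bound {B : ℝ} (hB : ∀ x, ‖q x‖ ≤ B) :
    ∃ K, 0 ≤ K ∧ ∀ x u, ‖(X q₀ z (q x)).mulVec u‖ ≤ K * ‖u‖ := by
  have hB0 : 0 ≤ B := (norm_nonneg _).trans (hB 0)
  exact ⟨3 * (|k q₀ z| + B), by positivity, fun x => norm_mulVec_le_of_entry_le (by positivity)
    fun i j => (norm_X_apply_le _ i j).trans (by gcongr; exact hB x)⟩

/-- `ψ` solves the scattering problem with potential `q`. -/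
def IsFundamental (q₀ z : ℝ) (q : ℝ → EuclideanSpace ℂ (Fin 2))
    (ψ : ℝ → Matrix (Fin 3) (Fin 3) ℂ) : Prop :=
  ∀ x i j, HasDerivAt (fun y => ψ y i j) ((X q₀ z (q x) * ψ x) i j) x

lemma IsFundamental.mul_right {ψ : ℝ → Matrix (Fin 3) (Fin 3) ℂ} (h : IsFundamental q₀ z q ψ)
    (M : Matrix (Fin 3) (Fin 3) ℂ) : IsFundamental q₀ z q fun x => ψ x * M := by
  intro x i j
  rw [← Matrix.mul_assoc, Matrix.mul_apply]
  simp only [Matrix.mul_apply (N := M)]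
  exact HasDerivAt.fun_sum fun s _ => (h x i s).mul_const _

lemma IsFundamental.mulVec {ψ : ℝ → Matrix (Fin 3) (Fin 3) ℂ} (h : IsFundamental q₀ z q ψ)
    (c : Fin 3 → ℂ) (x : ℝ) :
    HasDerivAt (fun x => (ψ x).mulVec c) ((X q₀ z (q x)).mulVec ((ψ x).mulVec c)) x := by
  rw [hasDerivAt_pi]
  intro i
  rw [Matrix.mulVec_mulVec]
  exact HasDerivAt.fun_sum (u := Finset.univ) (A := fun s x => ψ x i s * c s)
    fun s _ => (h x i s).mul_const _

lemma ext_mulVec {M N : Matrix (Fin 3) (Fin 3) ℂ} (h : ∀ c, M.mulVec c = N.mulVec c) : M = N :=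
  Matrix.mulVec_injective (funext h)

lemma IsFundamental.eq_of_eq {B : ℝ} (hB : ∀ x, ‖q x‖ ≤ B) {ψ φ : ℝ → Matrix (Fin 3) (Fin 3) ℂ}
    (hψ : IsFundamental q₀ z q ψ) (hφ : IsFundamental q₀ z q φ) {x₀ : ℝ} (h : ψ x₀ = φ x₀) :
    ψ = φ := by
  obtain ⟨K, -, hK⟩ := exists_X_bound (q₀ := q₀) (z := z) hB
  funext x
  refine ext_mulVec fun c => ?_
  exact congrFun (linear_solution_unique hK (hψ.mulVec c) (hφ.mulVec c) (x₀ := x₀)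
    (by simp only [h])) x

lemma exists_isFundamental (hq : Continuous q) {B : ℝ} (hB : ∀ x, ‖q x‖ ≤ B) :
    ∃ Φ, Φ 0 = 1 ∧ IsFundamental q₀ z q Φ := by
  obtain ⟨K, hK0, hK⟩ := exists_X_bound (q₀ := q₀) (z := z) hB
  choose y hy0 hy using fun j : Fin 3 =>
    exists_linear_solution (continuous_X (q₀ := q₀) (z := z) hq) hK0 hK (Pi.single j 1)
  refine ⟨fun x => Matrix.of fun i j => y j x i, ?_, fun x i j => ?_⟩
  · ext i j
    simp [hy0, Matrix.one_apply, Pi.single_apply]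
  · exact hasDerivAt_pi.1 (hy j x) i

/-- A solution whose amplitudes tend to zero vanishes. -/
lemma solution_eq_zero_of_tendsto_zero [l.NeBot] (hq₀ : 0 < q₀) (hv : ‖v‖ = q₀) (hz : z ≠ 0)
    (h1 : z ≠ q₀) (h2 : z ≠ -q₀) {B : ℝ} (hB : ∀ x, ‖q x‖ ≤ B) (htail : ControlsTail l q v)
    {y : ℝ → Fin 3 → ℂ} (hy : ∀ x, HasDerivAt y ((X q₀ z (q x)).mulVec (y x)) x)
    (hlim : Tendsto (fun x => (gauge q₀ z v x).mulVec (y x)) l (𝓝 0)) : y = 0 := by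
  obtain ⟨C, hC0, hC⟩ := exists_gauge_bound hq₀ hv h1 h2
  have hCε : C * (1 / (4 * (C + 1))) ≤ 1 / 4 := by
    rw [mul_one_div, div_le_div_iff₀ (by positivity) (by norm_num)]; linarith
  obtain ⟨R, hR⟩ := (htail.norm_sub_le (1 / (4 * (C + 1))) (by positivity)).exists
  -- With limit `0` the relative tail estimate says that the amplitudes vanish at `R`.
  have h := hR C _ _ 0 hC0 hCε (fun x => hasDerivAt_gauge_mulVec hq₀ hv hz h1 h2 (hy x))
    (fun x => hC _ _ x) hlim
  rw [norm_zero, mul_zero, sub_zero, norm_le_zero_iff] at h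
  have hyR : y R = 0 := by
    have := congrArg (gaugeInv q₀ z v R).mulVec h
    rwa [Matrix.mulVec_mulVec, gaugeInv_mul_gauge hq₀ hv h1 h2, Matrix.one_mulVec,
      Matrix.mulVec_zero] at this
  obtain ⟨K, -, hK⟩ := exists_X_bound (q₀ := q₀) (z := z) hB
  refine linear_solution_unique hK hy (w := 0) (fun x => ?_) hyR
  rw [Pi.zero_apply, Matrix.mulVec_zero]
  exact hasDerivAt_const x 0

lemma tendsto_mulVec {M : ℝ → Matrix (Fin 3) (Fin 3) ℂ} {L : Matrix (Fin 3) (Fin 3) ℂ}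
    (h : Tendsto M l (𝓝 L)) (c : Fin 3 → ℂ) :
    Tendsto (fun x => (M x).mulVec c) l (𝓝 (L.mulVec c)) :=
  ((continuous_id.matrix_mulVec continuous_const).tendsto L).comp h

/-- Existence of solutions with prescribed limiting amplitudes. -/
lemma exists_isFundamental_tendsto [l.NeBot] (hq₀ : 0 < q₀) (hv : ‖v‖ = q₀) (hz : z ≠ 0)
    (h1 : z ≠ q₀) (h2 : z ≠ -q₀) (hq : Continuous q) {B : ℝ} (hB : ∀ x, ‖q x‖ ≤ B)
    (htail : ControlsTail l q v) (D : Matrix (Fin 3) (Fin 3) ℂ) :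
    ∃ ψ, IsFundamental q₀ z q ψ ∧ Tendsto (fun x => gauge q₀ z v x * ψ x) l (𝓝 D) := by
  obtain ⟨Φ, hΦ0, hΦ⟩ := exists_isFundamental (q₀ := q₀) (z := z) hq hB
  obtain ⟨C, hC0, hC⟩ := exists_gauge_bound hq₀ hv h1 h2
  choose L hL using fun j : Fin 3 => htail.exists_tendsto C _ _ hC0
    (fun x => hasDerivAt_gauge_mulVec hq₀ hv hz h1 h2 (hΦ.mulVec (Pi.single j 1) x))
    (fun x => hC _ _ x)
  have hL' : Tendsto (fun x => gauge q₀ z v x * Φ x) l (𝓝 (Matrix.of fun i j => L j i)) := by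
    rw [tendsto_matrix_iff]
    intro i j
    simpa [Matrix.mulVec_mulVec, Matrix.mulVec_single] using! tendsto_pi_nhds.1 (hL j) i
  set M : Matrix (Fin 3) (Fin 3) ℂ := Matrix.of fun i j => L j i
  -- A kernel vector `c` of the limit matrix yields a solution `Φ c` with vanishing amplitudes,
  -- hence `Φ c = 0`, and `Φ 0 = 1` gives `c = 0`.
  have hM : IsUnit M := by
    rw [Matrix.isUnit_iff_isUnit_det, isUnit_iff_ne_zero]
    intro hdet
    obtain ⟨c, hc0, hc⟩ := Matrix.exists_mulVec_eq_zero_iff.2 hdet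
    refine hc0 ?_
    have h := solution_eq_zero_of_tendsto_zero hq₀ hv hz h1 h2 hB htail (hΦ.mulVec c)
      (by simpa [Matrix.mulVec_mulVec, hc] using tendsto_mulVec hL' c)
    simpa [hΦ0] using congrFun h 0
  have hdet : IsUnit M.det := (Matrix.isUnit_iff_isUnit_det M).1 hM
  refine ⟨fun x => Φ x * (M⁻¹ * D), hΦ.mul_right _, ?_⟩
  have h := ((continuous_id.mul (continuous_const (y := M⁻¹ * D))).tendsto M).comp hL'
  simpa [Function.comp_def, Matrix.mul_assoc, Matrix.mul_nonsing_inv_cancel_left _ _ hdet] using h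

lemma isJost_iff {q : ℝ → ℝ → EuclideanSpace ℂ (Fin 2)} (hq₀ : 0 < q₀) (hv : ‖v‖ = q₀)
    (hz : z ≠ 0) (h1 : z ≠ q₀) (h2 : z ≠ -q₀) {ψ : ℝ → Matrix (Fin 3) (Fin 3) ℂ} :
    IsJost σ q₀ q t z l v ψ ↔ IsFundamental q₀ z (fun x => q x t) ψ ∧
      Tendsto (fun x => gauge q₀ z v x * ψ x) l (𝓝 (Matrix.diagonal (amplitude σ q₀ z t))) :=
  ⟨fun h => ⟨h.1, (tendsto_jost_iff hq₀ hv hz h1 h2).1 h.2⟩,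
    fun h => ⟨h.1, (tendsto_jost_iff hq₀ hv hz h1 h2).2 h.2⟩⟩

lemma isJost_unique [l.NeBot] {q : ℝ → ℝ → EuclideanSpace ℂ (Fin 2)} (hq₀ : 0 < q₀)
    (hv : ‖v‖ = q₀) (hz : z ≠ 0) (h1 : z ≠ q₀) (h2 : z ≠ -q₀) {B : ℝ} (hB : ∀ x, ‖q x t‖ ≤ B)
    (htail : ControlsTail l (fun x => q x t) v) {ψ φ : ℝ → Matrix (Fin 3) (Fin 3) ℂ}
    (hψ : IsJost σ q₀ q t z l v ψ) (hφ : IsJost σ q₀ q t z l v φ) : ψ = φ := by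
  rw [isJost_iff hq₀ hv hz h1 h2] at hψ hφ
  funext x
  refine ext_mulVec fun c => ?_
  have hd : ∀ x, HasDerivAt (fun x => (ψ x).mulVec c - (φ x).mulVec c)
      ((X q₀ z (q x t)).mulVec ((ψ x).mulVec c - (φ x).mulVec c)) x := fun x => by
    rw [Matrix.mulVec_sub]
    exact (hψ.1.mulVec c x).sub (hφ.1.mulVec c x)
  have h := solution_eq_zero_of_tendsto_zero (q := fun x => q x t) hq₀ hv hz h1 h2 hB htail hd
    (by simpa [Matrix.mulVec_sub, Matrix.mulVec_mulVec] using
      (tendsto_mulVec hψ.2 c).sub (tendsto_mulVec hφ.2 c))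
  exact sub_eq_zero.1 (congrFun h x)

/-- The time phases cancel, and the scaling gives `ρ̂² (z² - q₀²) / z² = ρ̂`. The result does not
depend on `v`, so both Jost solutions carry the same form. -/
lemma eigenNorm_mul_amplitude (hq₀ : 0 < q₀) (hz : z ≠ 0) (h1 : z ≠ q₀) (h2 : z ≠ -q₀) :
    (Matrix.diagonal (amplitude σ q₀ z t)).conjTranspose * Matrix.diagonal (eigenNorm q₀ z) *
      Matrix.diagonal (amplitude σ q₀ z t) =
        Matrix.diagonal ![(rho q₀ z : ℂ), -1, -(rho q₀ z : ℂ)] := by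
  have hz' : (z : ℂ) ≠ 0 := by exact_mod_cast hz
  have hq' : (q₀ : ℂ) ≠ 0 := by exact_mod_cast hq₀.ne'
  have hzq := sq_sub_sq_ne_zero h1 h2
  have hrho : (rho q₀ z : ℂ) = z ^ 2 / (z ^ 2 - q₀ ^ 2) := by simp [rho]
  have hconj : ∀ j, star (amplitude σ q₀ z t j) * amplitude σ q₀ z t j =
      star (scale q₀ z j) * scale q₀ z j := fun j => by
    have h := norm_exp_I_mul (timePhase σ q₀ z t j)
    have h' : star (exp (I * timePhase σ q₀ z t j)) * exp (I * timePhase σ q₀ z t j) = 1 := by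
      have := Complex.normSq_eq_conj_mul_self (z := exp (I * timePhase σ q₀ z t j))
      rw [Complex.normSq_eq_norm_sq, h] at this
      simpa using this.symm
    simp only [amplitude, star_mul']
    linear_combination star (scale q₀ z j) * scale q₀ z j * h'
  rw [Matrix.diagonal_conjTranspose, Matrix.diagonal_mul_diagonal, Matrix.diagonal_mul_diagonal,
    Matrix.diagonal_eq_diagonal_iff]
  intro j
  rw [mul_right_comm, Pi.star_apply, hconj]
  fin_cases j <;> simp [scale, eigenNorm, hrho] <;> field_simp <;> simp

/-- The indefinite form `ψ† J ψ` of a Jost solution is constant. -/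
lemma IsJost.conjTranspose_mul [l.NeBot] {q : ℝ → ℝ → EuclideanSpace ℂ (Fin 2)} (hq₀ : 0 < q₀)
    (hv : ‖v‖ = q₀) (hz : z ≠ 0) (h1 : z ≠ q₀) (h2 : z ≠ -q₀)
    {ψ : ℝ → Matrix (Fin 3) (Fin 3) ℂ} (hψ : IsJost σ q₀ q t z l v ψ) (x : ℝ) :
    (ψ x).conjTranspose * J * ψ x =
      Matrix.diagonal ![(rho q₀ z : ℂ), -1, -(rho q₀ z : ℂ)] := by
  rw [isJost_iff hq₀ hv hz h1 h2] at hψ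
  obtain ⟨hψ, hlim⟩ := hψ
  have hderiv : ∀ i j y, HasDerivAt (fun x => ((ψ x).conjTranspose * J * ψ x) i j) 0 y := by
    intro i j y
    have h1 : ∀ s, HasDerivAt (fun x => ((ψ x).conjTranspose * J) i s)
        (((X q₀ z (q y t) * ψ y).conjTranspose * J) i s) y := fun s => by
      simp only [Matrix.mul_apply, Matrix.conjTranspose_apply]
      refine HasDerivAt.fun_sum fun r _ => HasDerivAt.mul_const ?_ _
      have := (hψ y r i).star
      simpa [Matrix.mul_apply] using! this
    have h2 : HasDerivAt (fun x => ((ψ x).conjTranspose * J * ψ x) i j)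
        (((X q₀ z (q y t) * ψ y).conjTranspose * J * ψ y +
          (ψ y).conjTranspose * J * (X q₀ z (q y t) * ψ y)) i j) y := by
      rw [Matrix.add_apply, Matrix.mul_apply, Matrix.mul_apply, ← Finset.sum_add_distrib]
      simp only [Matrix.mul_apply (M := (ψ _).conjTranspose * J)]
      exact HasDerivAt.fun_sum fun s _ => (h1 s).mul (hψ y s j)
    refine h2.congr_deriv ?_
    have h3 : (X q₀ z (q y t) * ψ y).conjTranspose * J * ψ y +
        (ψ y).conjTranspose * J * (X q₀ z (q y t) * ψ y) = (ψ y).conjTranspose *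
          ((X q₀ z (q y t)).conjTranspose * J + J * X q₀ z (q y t)) * ψ y := by
      simp only [Matrix.conjTranspose_mul, Matrix.mul_add, Matrix.add_mul, Matrix.mul_assoc]
    rw [h3, X_conjTranspose_mul_J]
    simp
  have hconst : ∀ y, (ψ y).conjTranspose * J * ψ y = (ψ x).conjTranspose * J * ψ x := fun y => by
    ext i j
    exact is_const_of_deriv_eq_zero (fun y => (hderiv i j y).differentiableAt)
      (fun y => (hderiv i j y).deriv) y x
  have hform : ∀ y, (ψ y).conjTranspose * J * ψ y =
      (gauge q₀ z v y * ψ y).conjTranspose * Matrix.diagonal (eigenNorm q₀ z) *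
        (gauge q₀ z v y * ψ y) := fun y => by
    have hG : (gaugeInv q₀ z v y).conjTranspose * J * gaugeInv q₀ z v y =
        Matrix.diagonal (eigenNorm q₀ z) := by
      have h := eigenbasis_conjTranspose_mul (z := z) hq₀ hv
      have : (gaugeInv q₀ z v y).conjTranspose * J * gaugeInv q₀ z v y =
          (Matrix.diagonal fun j => exp (I * (freq q₀ z j * y : ℝ))).conjTranspose *
            ((eigenbasis q₀ z v).conjTranspose * J * eigenbasis q₀ z v) *
            (Matrix.diagonal fun j => exp (I * (freq q₀ z j * y : ℝ))) := by
        simp only [gaugeInv, Matrix.conjTranspose_mul, Matrix.mul_assoc]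
      rw [this, h, Matrix.diagonal_conjTranspose, Matrix.diagonal_mul_diagonal,
        Matrix.diagonal_mul_diagonal, Matrix.diagonal_eq_diagonal_iff]
      intro j
      have h' : star (exp (I * (freq q₀ z j * y : ℝ))) * exp (I * (freq q₀ z j * y : ℝ)) = 1 := by
        have := Complex.normSq_eq_conj_mul_self (z := exp (I * (freq q₀ z j * y : ℝ)))
        rw [Complex.normSq_eq_norm_sq, norm_exp_I_mul] at this
        simpa using this.symm
      rw [Pi.star_apply]
      linear_combination eigenNorm q₀ z j * h'
    have hψy : ψ y = gaugeInv q₀ z v y * (gauge q₀ z v y * ψ y) := by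
      rw [← Matrix.mul_assoc, gaugeInv_mul_gauge hq₀ hv ‹_› ‹_›, Matrix.one_mul]
    conv_lhs => rw [hψy]
    rw [← hG]
    simp only [Matrix.conjTranspose_mul (gaugeInv q₀ z v y), Matrix.mul_assoc]
  rw [← eigenNorm_mul_amplitude (σ := σ) (t := t) hq₀ hz h1 h2]
  have hc : Continuous fun M : Matrix (Fin 3) (Fin 3) ℂ =>
      M.conjTranspose * Matrix.diagonal (eigenNorm q₀ z) * M :=
    (continuous_id.matrix_conjTranspose.mul continuous_const).mul continuous_id
  -- The constant form equals its limit along `l`, where the amplitudes become diagonal.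
  refine tendsto_nhds_unique (tendsto_const_nhds (f := l)) (((hc.tendsto _).comp hlim).congr ?_)
  exact fun y => (hform y).symm.trans (hconst y)

end Jost

/-! ### The scattering matrix -/

section Scattering

variable {σ q₀ z t : ℝ} {qm qp : EuclideanSpace ℂ (Fin 2)}
  {q : ℝ → ℝ → EuclideanSpace ℂ (Fin 2)}

lemma rho_ne_zero (hz : z ≠ 0) (h1 : z ≠ q₀) (h2 : z ≠ -q₀) : (rho q₀ z : ℂ) ≠ 0 := by
  have hzq := sq_sub_sq_ne_zero h1 h2
  have hz' : (z : ℂ) ≠ 0 := by exact_mod_cast hz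
  simp only [rho, ofReal_div, ofReal_sub, ofReal_pow]
  exact div_ne_zero (pow_ne_zero _ hz') hzq

lemma diagonal_rho_mul (hz : z ≠ 0) (h1 : z ≠ q₀) (h2 : z ≠ -q₀) :
    Matrix.diagonal ![(rho q₀ z : ℂ)⁻¹, -1, -(rho q₀ z : ℂ)⁻¹] *
      Matrix.diagonal ![(rho q₀ z : ℂ), -1, -(rho q₀ z : ℂ)] = 1 := by
  have h := rho_ne_zero hz h1 h2
  rw [Matrix.diagonal_mul_diagonal, ← Matrix.diagonal_one, Matrix.diagonal_eq_diagonal_iff]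
  intro j
  fin_cases j <;> simp [h]

lemma IsJost.isUnit_det {l : Filter ℝ} [l.NeBot] {v : EuclideanSpace ℂ (Fin 2)} (hq₀ : 0 < q₀)
    (hv : ‖v‖ = q₀) (hz : z ≠ 0) (h1 : z ≠ q₀) (h2 : z ≠ -q₀)
    {ψ : ℝ → Matrix (Fin 3) (Fin 3) ℂ} (hψ : IsJost σ q₀ q t z l v ψ) (x : ℝ) :
    IsUnit (ψ x).det := by
  have h := congrArg (Matrix.diagonal ![(rho q₀ z : ℂ)⁻¹, -1, -(rho q₀ z : ℂ)⁻¹] * ·)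
    (hψ.conjTranspose_mul hq₀ hv hz h1 h2 x)
  simp only [diagonal_rho_mul hz h1 h2, ← Matrix.mul_assoc] at h
  exact Matrix.isUnit_det_of_left_inverse h

/-- Both `ψ₊` and `ψ₋ H` solve the same system, so the value of `H` at `x = 0` suffices. Uniqueness
follows from that of the Jost solutions and the invertibility of `ψ₋`. -/
lemma existsUnique_isScatteringMatrix (hq₀ : 0 < q₀) (hqm : ‖qm‖ = q₀) (hqp : ‖qp‖ = q₀)
    (hz : z ≠ 0) (h1 : z ≠ q₀) (h2 : z ≠ -q₀) (hq : Continuous fun x => q x t) {B : ℝ}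
    (hB : ∀ x, ‖q x t‖ ≤ B) (hbot : ControlsTail atBot (fun x => q x t) qm)
    (htop : ControlsTail atTop (fun x => q x t) qp) :
    ∃! H, IsScatteringMatrix σ q₀ qm qp q t z H := by
  obtain ⟨ψm, hm⟩ := exists_isFundamental_tendsto hq₀ hqm hz h1 h2 hq hB hbot
    (Matrix.diagonal (amplitude σ q₀ z t))
  obtain ⟨ψp, hp⟩ := exists_isFundamental_tendsto hq₀ hqp hz h1 h2 hq hB htop
    (Matrix.diagonal (amplitude σ q₀ z t))
  have hjm : IsJost σ q₀ q t z atBot qm ψm := (isJost_iff hq₀ hqm hz h1 h2).2 hm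
  have hjp : IsJost σ q₀ q t z atTop qp ψp := (isJost_iff hq₀ hqp hz h1 h2).2 hp
  refine ⟨(ψm 0)⁻¹ * ψp 0, ⟨ψm, ψp, hjm, hjp, fun x => ?_⟩, ?_⟩
  · refine congrFun (hp.1.eq_of_eq hB (hm.1.mul_right _) (x₀ := 0) ?_) x
    exact (Matrix.mul_nonsing_inv_cancel_left _ _ (hjm.isUnit_det hq₀ hqm hz h1 h2 0)).symm
  · rintro H ⟨φm, φp, hφm, hφp, hH⟩
    obtain rfl := isJost_unique hq₀ hqm hz h1 h2 hB hbot hφm hjm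
    obtain rfl := isJost_unique hq₀ hqp hz h1 h2 hB htop hφp hjp
    rw [hH 0, Matrix.nonsing_inv_mul_cancel_left _ _ (hjm.isUnit_det hq₀ hqm hz h1 h2 0)]

/-- The scattering matrix preserves the indefinite form. -/
lemma IsScatteringMatrix.conjTranspose_mul (hq₀ : 0 < q₀) (hqm : ‖qm‖ = q₀) (hqp : ‖qp‖ = q₀)
    (hz : z ≠ 0) (h1 : z ≠ q₀) (h2 : z ≠ -q₀) {H : Matrix (Fin 3) (Fin 3) ℂ}
    (hH : IsScatteringMatrix σ q₀ qm qp q t z H) :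
    H.conjTranspose * Matrix.diagonal ![(rho q₀ z : ℂ), -1, -(rho q₀ z : ℂ)] * H =
      Matrix.diagonal ![(rho q₀ z : ℂ), -1, -(rho q₀ z : ℂ)] := by
  obtain ⟨ψm, ψp, hm, hp, h⟩ := hH
  have hp' := hp.conjTranspose_mul hq₀ hqp hz h1 h2 0
  have hm' := hm.conjTranspose_mul hq₀ hqm hz h1 h2 0
  rw [h 0, Matrix.conjTranspose_mul] at hp'
  conv_rhs => rw [← hp']
  rw [← hm']
  simp only [Matrix.mul_assoc]

/-- Without reflection the first column of `H` is a unimodular multiple of the first basis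
vector. -/
lemma IsScatteringMatrix.of_reflectionVanishes (hq₀ : 0 < q₀) (hqm : ‖qm‖ = q₀)
    (hqp : ‖qp‖ = q₀) (hz : z ≠ 0) (h1 : z ≠ q₀) (h2 : z ≠ -q₀)
    {H : Matrix (Fin 3) (Fin 3) ℂ} (hH : IsScatteringMatrix σ q₀ qm qp q t z H)
    (hr : ReflectionVanishes H) : H 1 0 = 0 ∧ H 2 0 = 0 ∧ ‖H 0 0‖ = 1 := by
  have hrho := rho_ne_zero hz h1 h2
  have h := hH.conjTranspose_mul hq₀ hqm hqp hz h1 h2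
  have h10 : H 1 0 = 0 := (div_eq_zero_iff.1 hr.beta₂_eq_zero).resolve_right hr.h₁₁_ne_zero
  have hS : H⁻¹ 0 2 = 0 := (div_eq_zero_iff.1 hr.beta₁_eq_zero).resolve_right hr.s₁₁_ne_zero
  have hinv : H⁻¹ = Matrix.diagonal ![(rho q₀ z : ℂ)⁻¹, -1, -(rho q₀ z : ℂ)⁻¹] *
      H.conjTranspose * Matrix.diagonal ![(rho q₀ z : ℂ), -1, -(rho q₀ z : ℂ)] := by
    refine Matrix.inv_eq_left_inv ?_
    rw [Matrix.mul_assoc, Matrix.mul_assoc, ← Matrix.mul_assoc H.conjTranspose, h,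
      diagonal_rho_mul hz h1 h2]
  -- The formula for `H⁻¹` shows that `s₁₃` is minus the conjugate of `h₃₁`.
  have h20 : H 2 0 = 0 := by
    rw [hinv, Matrix.mul_diagonal, Matrix.diagonal_mul] at hS
    simpa [hrho] using hS
  refine ⟨h10, h20, ?_⟩
  have h00 := congrFun (congrFun h 0) 0
  rw [Matrix.mul_apply] at h00
  simp only [Matrix.mul_diagonal, Fin.sum_univ_three, Matrix.conjTranspose_apply, h10, h20] at h00
  simp only [Matrix.diagonal_apply_eq, Matrix.cons_val_zero, mul_zero, add_zero] at h00
  have h' : star (H 0 0) * H 0 0 = 1 := by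
    apply mul_right_cancel₀ hrho
    linear_combination h00
  have h3 : ‖H 0 0‖ * ‖H 0 0‖ = 1 := by
    simpa using congrArg norm h'
  nlinarith [norm_nonneg (H 0 0)]

end Scattering

/-! ### The limit of small spectral parameter -/

section SmallParameter

variable {q₀ z : ℝ} {v : EuclideanSpace ℂ (Fin 2)} {q : ℝ → EuclideanSpace ℂ (Fin 2)}

lemma norm_eigenbasis_apply_le (hq₀ : 0 < q₀) (hv : ‖v‖ = q₀) (hz : 0 < z) (hz' : z ≤ q₀ / 2)
    (i j : Fin 3) : ‖eigenbasis q₀ z v i j‖ ≤ q₀ := by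
  have h : ∀ i, ‖v i‖ ≤ q₀ := fun i => hv ▸ PiLp.norm_apply_le v i
  have h' : ∀ i, z * ‖v i‖ / q₀ ≤ q₀ := fun i => by
    rw [div_le_iff₀ hq₀]
    exact mul_le_mul (by linarith) (h i) (norm_nonneg _) hq₀.le
  fin_cases i <;> fin_cases j <;>
    simp [eigenbasis, perp, abs_of_pos, hz, hq₀, hq₀.le, h, h']; linarith

/-- The condition `z ≤ q₀ / 2` keeps `q₀² - z²` above `q₀² / 2`. The bound does not involve `z`,
which makes the tail estimates uniform as `z → 0`. -/
lemma norm_eigenbasisInv_apply_le (hq₀ : 0 < q₀) (hv : ‖v‖ = q₀) (hz : 0 < z)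
    (hz' : z ≤ q₀ / 2) (i j : Fin 3) : ‖eigenbasisInv q₀ z v i j‖ ≤ 2 / q₀ := by
  have h : ∀ i, ‖v i‖ ≤ q₀ := fun i => hv ▸ PiLp.norm_apply_le v i
  have hd : q₀ ^ 2 / 2 ≤ ‖(z ^ 2 - q₀ ^ 2 : ℂ)‖ := by
    rw [← ofReal_pow, ← ofReal_pow, ← ofReal_sub, norm_real, Real.norm_eq_abs, abs_sub_comm]
    refine le_trans ?_ (le_abs_self _)
    nlinarith
  have key : ∀ a, a ≤ q₀ → a / ‖(z ^ 2 - q₀ ^ 2 : ℂ)‖ ≤ 2 / q₀ := fun a ha => by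
    have hpos : 0 < ‖(z ^ 2 - q₀ ^ 2 : ℂ)‖ := lt_of_lt_of_le (by positivity) hd
    rw [div_le_div_iff₀ hpos hq₀]
    nlinarith
  have h' : ∀ i, z * ‖v i‖ / q₀ / ‖(z ^ 2 - q₀ ^ 2 : ℂ)‖ ≤ 2 / q₀ := fun i => by
    refine key _ ?_
    rw [div_le_iff₀ hq₀]
    exact mul_le_mul (by linarith) (h i) (norm_nonneg _) hq₀.le
  have h'' : ∀ i, ‖v i‖ / q₀ ^ 2 ≤ 2 / q₀ := fun i => by
    rw [div_le_div_iff₀ (by positivity) hq₀]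
    nlinarith [h i]
  have h0 : 0 ≤ 2 / q₀ := by positivity
  fin_cases i <;> fin_cases j <;>
    simp [eigenbasisInv, abs_of_pos, hz, hq₀, h0, h', h'', key _ (h _), key _ le_rfl,
      key z (by linarith)]

/-- The value of `exp (i λ x) (z, v)`, the first eigensolution of the limit problem. -/
def planeWave (q₀ z : ℝ) (v : EuclideanSpace ℂ (Fin 2)) (x : ℝ) (i : Fin 3) : ℂ :=
  exp (I * (lam q₀ z * x : ℝ)) * eigenbasis q₀ z v i 0

/-- Far out, solutions with reflectionless asymptotics are close to plane waves, uniformly in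
small `z`. -/
lemma eventually_norm_sub_planeWave_le {l : Filter ℝ} (hq₀ : 0 < q₀) (hv : ‖v‖ = q₀)
    (htail : ControlsTail l q v) {ε : ℝ} (hε : 0 < ε) (hε' : 216 * ε ≤ 1) :
    ∀ᶠ R in l, ∀ (z : ℝ) (y : ℝ → Fin 3 → ℂ) (h : ℂ), 0 < z → z ≤ q₀ / 2 → ‖h‖ = 1 →
      (∀ x, HasDerivAt y ((X q₀ z (q x)).mulVec (y x)) x) →
      Tendsto (fun x => (gauge q₀ z v x).mulVec (y x)) l (𝓝 (Pi.single 0 h)) →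
      ‖y R - h • planeWave q₀ z v R‖ ≤ 648 * q₀ * ε := by
  filter_upwards [htail.norm_sub_le ε hε] with R hR z y h hz hz' hh hy hlim
  have h1 : z ≠ q₀ := by intro e; linarith
  have h2 : z ≠ -q₀ := by intro e; linarith
  have hm := norm_eigenbasis_apply_le hq₀ hv hz hz'
  -- The entry bounds `q₀` and `2 / q₀` give the constant 54. Thus `216 * ε ≤ 1` is the tail
  -- condition `54 * ε ≤ 1/4`, and `648 = 3 * 4 * 54`.
  have hC : 27 * q₀ * (2 / q₀) = 54 := by field_simp; norm_num
  have hg := hR (27 * q₀ * (2 / q₀)) _ _ _ (by positivity) (by rw [hC]; linarith)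
    (fun x => hasDerivAt_gauge_mulVec hq₀ hv hz.ne' h1 h2 (hy x))
    (fun x => norm_gauge_mulVec_deriv_le hq₀ hv h1 h2 hm
      (norm_eigenbasisInv_apply_le hq₀ hv hz hz') _ _ x) hlim
  rw [hC, Pi.norm_single, hh, mul_one] at hg
  have hI := norm_mulVec_le_of_entry_le hq₀.le (M := gaugeInv q₀ z v R)
      (fun i j => (norm_gaugeInv_apply R i j).trans_le (hm i j))
      ((gauge q₀ z v R).mulVec (y R) - Pi.single 0 h)
  have hsingle : (gaugeInv q₀ z v R).mulVec (Pi.single 0 h) = h • planeWave q₀ z v R := by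
    funext i
    rw [Matrix.mulVec_single]
    simp [gaugeInv, planeWave, freq, Matrix.mul_diagonal]
    ring
  rw [Matrix.mulVec_sub, Matrix.mulVec_mulVec, gaugeInv_mul_gauge hq₀ hv h1 h2,
    Matrix.one_mulVec, hsingle] at hI
  calc _ ≤ _ := hI
    _ ≤ 3 * q₀ * (4 * (54 * ε)) := by gcongr
    _ = _ := by ring

lemma norm_planeWave_le (hq₀ : 0 < q₀) (hv : ‖v‖ = q₀) (hz : 0 < z) (hz' : z ≤ q₀ / 2) (x : ℝ) :
    ‖planeWave q₀ z v x‖ ≤ q₀ := by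
  rw [pi_norm_le_iff_of_nonneg hq₀.le]
  intro i
  rw [planeWave, norm_mul, norm_exp_I_mul, one_mul]
  exact norm_eigenbasis_apply_le hq₀ hv hz hz' i 0

lemma X_mulVec_zero (w : EuclideanSpace ℂ (Fin 2)) (u : Fin 3 → ℂ) :
    (X q₀ z w).mulVec u 0 =
      I * k q₀ z * u 0 - I * (star (w 0) * u 1 + star (w 1) * u 2) := by
  simp [X_eq, Matrix.mulVec, dotProduct, Fin.sum_univ_three]
  ring

lemma X_mulVec_succ (w : EuclideanSpace ℂ (Fin 2)) (u : Fin 3 → ℂ) (i : Fin 2) :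
    (X q₀ z w).mulVec u i.succ = I * w i * u 0 - I * k q₀ z * u i.succ := by
  fin_cases i <;> simp [X_eq, Matrix.mulVec, dotProduct, Fin.sum_univ_three] <;> ring

lemma hasDerivAt_exp_mul {y : ℝ → ℂ} {y' : ℂ} {x : ℝ} (c : ℝ) (hy : HasDerivAt y y' x) :
    HasDerivAt (fun x : ℝ => exp (I * (c * x : ℝ)) * y x)
      (exp (I * (c * x : ℝ)) * (I * c * y x + y')) x := by
  have h : HasDerivAt (fun x : ℝ => I * (c * x : ℝ)) (I * c) x := by
    simpa using! ((hasDerivAt_id x).const_mul c).ofReal_comp.const_mul I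
  refine (h.cexp.mul hy).congr_deriv ?_
  ring

lemma norm_inner_part_le {B : ℝ} {w : EuclideanSpace ℂ (Fin 2)} (hw : ‖w‖ ≤ B) (u : Fin 3 → ℂ) :
    ‖star (w 0) * u 1 + star (w 1) * u 2‖ ≤ 2 * B * ‖u‖ := by
  have hB : 0 ≤ B := (norm_nonneg _).trans hw
  have h : ∀ (i : Fin 2) (j : Fin 3), ‖star (w i) * u j‖ ≤ B * ‖u‖ := fun i j => by
    rw [norm_mul, norm_star]
    exact mul_le_mul ((PiLp.norm_apply_le w i).trans hw) (norm_le_pi_norm u j) (norm_nonneg _) hB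
  calc _ ≤ _ := norm_add_le _ _
    _ ≤ B * ‖u‖ + B * ‖u‖ := add_le_add (h 0 1) (h 1 2)
    _ = _ := by ring

/-- Growth of solutions is bounded uniformly in the spectral parameter. -/
lemma norm_solution_le {B : ℝ} (hB : ∀ x, ‖q x‖ ≤ B) {y : ℝ → Fin 3 → ℂ}
    (hy : ∀ x, HasDerivAt y ((X q₀ z (q x)).mulVec (y x)) x) {R₁ R₂ x : ℝ}
    (hx : x ∈ Set.Icc R₁ R₂) : ‖y x‖ ≤ ‖y R₁‖ * Real.exp (2 * B * (x - R₁)) := by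
  have hB0 : 0 ≤ B := (norm_nonneg _).trans (hB 0)
  -- These phases remove the diagonal part `i k J`, which blows up as `z → 0`. Only the off-diagonal
  -- part, bounded through `B`, enters Grönwall's inequality.
  set s : Fin 3 → ℝ := ![-k q₀ z, k q₀ z, k q₀ z] with hs
  set w : ℝ → Fin 3 → ℂ := fun x i => exp (I * (s i * x : ℝ)) * y x i with hw
  have hwy : ∀ x, ‖w x‖ = ‖y x‖ := fun x => by
    simp only [Pi.norm_def, hw, nnnorm_mul]
    congr; funext i
    have : ‖exp (I * (s i * x : ℝ))‖₊ = 1 := NNReal.eq (norm_exp_I_mul _)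
    rw [this, one_mul]
  set w' : ℝ → Fin 3 → ℂ := fun x i =>
    exp (I * (s i * x : ℝ)) * (I * s i * y x i + (X q₀ z (q x)).mulVec (y x) i)
  have hd : ∀ x, HasDerivAt w (w' x) x := fun x =>
    hasDerivAt_pi.2 fun i => hasDerivAt_exp_mul (s i) (hasDerivAt_pi.1 (hy x) i)
  have hd' : ∀ x, ‖w' x‖ ≤ 2 * B * ‖w x‖ + 0 := fun x => by
    rw [add_zero, hwy, pi_norm_le_iff_of_nonneg (by positivity)]
    intro i
    simp only [w', norm_mul, norm_exp_I_mul, one_mul]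
    refine Fin.cases ?_ (fun i => ?_) i
    · rw [X_mulVec_zero]
      have : I * (s 0 : ℂ) * y x 0 + (I * k q₀ z * y x 0 -
          I * (star (q x 0) * y x 1 + star (q x 1) * y x 2)) =
          -I * (star (q x 0) * y x 1 + star (q x 1) * y x 2) := by
        simp only [hs, Matrix.cons_val_zero, ofReal_neg]; ring
      rw [this, norm_mul, norm_neg, norm_I, one_mul]
      exact norm_inner_part_le (hB x) (y x)
    · rw [X_mulVec_succ]
      have hsi : s i.succ = k q₀ z := by fin_cases i <;> rfl
      have : I * (s i.succ : ℂ) * y x i.succ + (I * q x i * y x 0 -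
          I * k q₀ z * y x i.succ) = I * (q x i * y x 0) := by
        rw [hsi]; ring
      rw [this, norm_mul, norm_I, one_mul, norm_mul]
      calc ‖q x i‖ * ‖y x 0‖ ≤ B * ‖y x‖ :=
            mul_le_mul ((PiLp.norm_apply_le (q x) i).trans (hB x)) (norm_le_pi_norm _ _)
              (norm_nonneg _) hB0
        _ ≤ 2 * B * ‖y x‖ := by nlinarith [norm_nonneg (y x)]
  have h := norm_le_gronwallBound_of_norm_deriv_right_le (f := w) (f' := w') (a := R₁) (b := R₂)
    (δ := ‖w R₁‖) (K := 2 * B) (ε := 0)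
    (fun x _ => (hd x).continuousAt.continuousWithinAt)
    (fun x _ => (hd x).hasDerivWithinAt) le_rfl (fun x _ => hd' x) x hx
  rwa [gronwallBound_ε0, hwy, hwy] at h

/-- The slow components of a solution vary by `O(z)` on a bounded interval. -/
lemma norm_slow_sub_le (hq₀ : 0 < q₀) (hz : 0 < z) {B B' M : ℝ} (hB : ∀ x, ‖q x‖ ≤ B)
    (hq : Differentiable ℝ q) {y : ℝ → Fin 3 → ℂ}
    (hy : ∀ x, HasDerivAt y ((X q₀ z (q x)).mulVec (y x)) x) {R₁ R₂ : ℝ} (hR : R₁ ≤ R₂)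
    (hB' : ∀ x ∈ Set.Icc R₁ R₂, ‖deriv q x‖ ≤ B') (hM : ∀ x ∈ Set.Icc R₁ R₂, ‖y x‖ ≤ M)
    (i : Fin 2) :
    ‖exp (I * (-lam q₀ z * R₂ : ℝ)) * y R₂ i.succ - exp (I * (-lam q₀ z * R₁ : ℝ)) * y R₁ i.succ‖
      ≤ z * (M * (1 + (B' + 2 * B * B) / q₀ ^ 2) * (R₂ - R₁) + 2 * (B * M / q₀ ^ 2)) := by
  have hB0 : 0 ≤ B := (norm_nonneg _).trans (hB 0)
  have hM0 : 0 ≤ M := (norm_nonneg _).trans (hM R₁ ⟨le_rfl, hR⟩)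
  have hB0' : 0 ≤ B' := (norm_nonneg _).trans (hB' R₁ ⟨le_rfl, hR⟩)
  have hz0 : (z : ℂ) ≠ 0 := by exact_mod_cast hz.ne'
  have hq0 : (q₀ : ℂ) ≠ 0 := by exact_mod_cast hq₀.ne'
  have hc : ‖(z / q₀ ^ 2 : ℂ)‖ = z / q₀ ^ 2 := by simp [abs_of_pos hz]
  set e : ℝ → ℂ := fun x => exp (I * (-lam q₀ z * x : ℝ))
  have he : ∀ x, ‖e x‖ = 1 := fun x => norm_exp_I_mul _
  have hqi : ∀ x, HasDerivAt (fun x => q x i) (deriv q x i) x := fun x => by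
    have := (EuclideanSpace.proj (𝕜 := ℂ) i).restrictScalars ℝ |>.hasFDerivAt.comp_hasDerivAt x
      (hq x).hasDerivAt
    simpa using! this
  -- Integration by parts in differential form: since `e * y₀` rotates at frequency `k - λ = q₀²/z`,
  -- the derivative of the subtracted term cancels the driving term `i q y₀`. Everything left
  -- carries a factor `z`.
  have hslow : ∀ x, HasDerivAt (fun x => e x * y x i.succ - z / q₀ ^ 2 * (q x i * (e x * y x 0)))
      (e x * (z * (-I * y x i.succ - 1 / q₀ ^ 2 * (deriv q x i * y x 0 -
        I * (q x i * (star (q x 0) * y x 1 + star (q x 1) * y x 2)))))) x := fun x => by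
    have hy' := hasDerivAt_pi.1 (hy x)
    refine ((hasDerivAt_exp_mul (-lam q₀ z) (hy' i.succ)).sub (((hqi x).mul
      (hasDerivAt_exp_mul (-lam q₀ z) (hy' 0))).const_mul (z / q₀ ^ 2 : ℂ))).congr_deriv ?_
    rw [X_mulVec_zero, X_mulVec_succ]
    simp only [e, k, lam]
    push_cast
    field_simp
    ring
  have hqn : ∀ x, ‖q x i‖ ≤ B := fun x => (PiLp.norm_apply_le (q x) i).trans (hB x)
  have hbound : ∀ x ∈ Set.Icc R₁ R₂, ‖e x * (z * (-I * y x i.succ - 1 / q₀ ^ 2 *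
      (deriv q x i * y x 0 - I * (q x i * (star (q x 0) * y x 1 + star (q x 1) * y x 2)))))‖ ≤
      z * (M * (1 + (B' + 2 * B * B) / q₀ ^ 2)) := fun x hx => by
    rw [norm_mul, he, one_mul, norm_mul, norm_real, Real.norm_eq_abs, abs_of_pos hz]
    refine mul_le_mul_of_nonneg_left ?_ hz.le
    have hy0 : ∀ j, ‖y x j‖ ≤ M := fun j => (norm_le_pi_norm _ j).trans (hM x hx)
    have h1 : ‖-I * y x i.succ‖ ≤ M := by simpa using hy0 i.succ
    have h2 : ‖deriv q x i * y x 0‖ ≤ B' * M := by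
      rw [norm_mul]
      exact mul_le_mul ((PiLp.norm_apply_le _ i).trans (hB' x hx)) (hy0 0) (norm_nonneg _) hB0'
    have h3 : ‖I * (q x i * (star (q x 0) * y x 1 + star (q x 1) * y x 2))‖ ≤
        B * (2 * B * M) := by
      rw [norm_mul, norm_I, one_mul, norm_mul]
      refine mul_le_mul (hqn x) ((norm_inner_part_le (hB x) (y x)).trans ?_) (norm_nonneg _) hB0
      have := hM x hx
      gcongr
    have h4 : ‖(1 / q₀ ^ 2 : ℂ)‖ = 1 / q₀ ^ 2 := by simp
    calc _ ≤ ‖-I * y x i.succ‖ + ‖(1 / q₀ ^ 2 : ℂ) * (deriv q x i * y x 0 -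
          I * (q x i * (star (q x 0) * y x 1 + star (q x 1) * y x 2)))‖ := norm_sub_le _ _
      _ ≤ M + 1 / q₀ ^ 2 * (B' * M + B * (2 * B * M)) := by
        rw [norm_mul (1 / q₀ ^ 2 : ℂ), h4]
        refine add_le_add h1 (mul_le_mul_of_nonneg_left ?_ (by positivity))
        exact (norm_sub_le _ _).trans (add_le_add h2 h3)
      _ = _ := by ring
  have hmv := norm_image_sub_le_of_norm_deriv_le_segment'
    (fun x _ => (hslow x).hasDerivWithinAt)
    (fun x hx => hbound x ⟨hx.1, hx.2.le⟩) R₂ ⟨hR, le_rfl⟩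
  have hsmall : ∀ x ∈ Set.Icc R₁ R₂,
      ‖(z / q₀ ^ 2 : ℂ) * (q x i * (e x * y x 0))‖ ≤ z * (B * M / q₀ ^ 2) := fun x hx => by
    rw [norm_mul, hc, norm_mul, norm_mul, he, one_mul]
    have h0 : ‖y x 0‖ ≤ M := (norm_le_pi_norm _ _).trans (hM x hx)
    calc _ ≤ z / q₀ ^ 2 * (B * M) := by gcongr; exact hqn x
      _ = _ := by ring
  have hs1 := hsmall R₁ ⟨le_rfl, hR⟩
  have hs2 := hsmall R₂ ⟨hR, le_rfl⟩
  change ‖e R₂ * y R₂ i.succ - e R₁ * y R₁ i.succ‖ ≤ _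
  set a₁ := (z / q₀ ^ 2 : ℂ) * (q R₁ i * (e R₁ * y R₁ 0))
  set a₂ := (z / q₀ ^ 2 : ℂ) * (q R₂ i * (e R₂ * y R₂ 0))
  calc ‖e R₂ * y R₂ i.succ - e R₁ * y R₁ i.succ‖
      = ‖(e R₂ * y R₂ i.succ - a₂ - (e R₁ * y R₁ i.succ - a₁)) + (a₂ - a₁)‖ := by
        congr 1; ring
    _ ≤ _ := norm_add_le _ _
    _ ≤ z * (M * (1 + (B' + 2 * B * B) / q₀ ^ 2)) * (R₂ - R₁) +
        (z * (B * M / q₀ ^ 2) + z * (B * M / q₀ ^ 2)) :=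
        add_le_add hmv ((norm_sub_le _ _).trans (add_le_add hs2 hs1))
    _ = _ := by ring

end SmallParameter

/-! ### Comparison of the two boundary values through reflectionless solutions -/

lemma exists_norm_bound {q : ℝ → EuclideanSpace ℂ (Fin 2)} (hq : Continuous q)
    {qm qp : EuclideanSpace ℂ (Fin 2)} (hbot : Tendsto q atBot (𝓝 qm))
    (htop : Tendsto q atTop (𝓝 qp)) : ∃ B, ∀ x, ‖q x‖ ≤ B := by
  obtain ⟨a, ha⟩ := eventually_atBot.1 (hbot.norm.eventually_le_const (lt_add_one ‖qm‖))
  obtain ⟨b, hb⟩ := eventually_atTop.1 (htop.norm.eventually_le_const (lt_add_one ‖qp‖))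
  obtain ⟨C, hC⟩ := (isCompact_Icc (a := a) (b := b)).exists_bound_of_continuousOn
    hq.continuousOn
  refine ⟨max C (max (‖qm‖ + 1) (‖qp‖ + 1)), fun x => ?_⟩
  rcases le_total x a with h | h
  · exact (ha x h).trans ((le_max_left _ _).trans (le_max_right _ _))
  rcases le_total b x with h' | h'
  · exact (hb x h').trans ((le_max_right _ _).trans (le_max_right _ _))
  · exact (hC x ⟨h, h'⟩).trans (le_max_left _ _)

lemma amplitude_zero_ne_zero {σ q₀ z t : ℝ} (hz : z ≠ 0) (h1 : z ≠ q₀) (h2 : z ≠ -q₀) :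
    amplitude σ q₀ z t 0 ≠ 0 := by
  have hz' : (z : ℂ) ≠ 0 := by exact_mod_cast hz
  refine mul_ne_zero ?_ (exp_ne_zero _)
  exact div_ne_zero (mul_ne_zero (rho_ne_zero hz h1 h2) I_ne_zero) hz'

/-- Without reflection there is a solution which is asymptotic to the first eigensolution at both
ends. -/
lemma exists_transparent_solution {σ q₀ z t : ℝ} {qm qp : EuclideanSpace ℂ (Fin 2)}
    {q : ℝ → ℝ → EuclideanSpace ℂ (Fin 2)} (hq₀ : 0 < q₀) (hqm : ‖qm‖ = q₀) (hqp : ‖qp‖ = q₀)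
    (hz : z ≠ 0) (h1 : z ≠ q₀) (h2 : z ≠ -q₀) {H : Matrix (Fin 3) (Fin 3) ℂ}
    (hH : IsScatteringMatrix σ q₀ qm qp q t z H) (hr : ReflectionVanishes H) :
    ∃ (y : ℝ → Fin 3 → ℂ) (h : ℂ), ‖h‖ = 1 ∧
      (∀ x, HasDerivAt y ((X q₀ z (q x t)).mulVec (y x)) x) ∧
      Tendsto (fun x => (gauge q₀ z qp x).mulVec (y x)) atTop (𝓝 (Pi.single 0 1)) ∧
      Tendsto (fun x => (gauge q₀ z qm x).mulVec (y x)) atBot (𝓝 (Pi.single 0 h)) := by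
  obtain ⟨h10, h20, h00⟩ := hH.of_reflectionVanishes hq₀ hqm hqp hz h1 h2 hr
  obtain ⟨ψm, ψp, hm, hp, hψ⟩ := hH
  rw [isJost_iff hq₀ hqm hz h1 h2] at hm
  rw [isJost_iff hq₀ hqp hz h1 h2] at hp
  have ha := amplitude_zero_ne_zero (σ := σ) (t := t) hz h1 h2
  -- Dividing by the amplitude removes the normalization and time phase of `Ŷ e^{iΔ}`, so the limits
  -- are `1` and `h₁₁` in the first slot.
  set c : Fin 3 → ℂ := Pi.single 0 (amplitude σ q₀ z t 0)⁻¹ with hc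
  have hHc : H.mulVec c = Pi.single 0 (H 0 0 * (amplitude σ q₀ z t 0)⁻¹) := by
    funext i
    fin_cases i <;> simp [hc, h10, h20]
  have hamp : ∀ b : ℂ, (Matrix.diagonal (amplitude σ q₀ z t)).mulVec
      (Pi.single 0 (b * (amplitude σ q₀ z t 0)⁻¹)) = Pi.single 0 b := fun b => by
    funext i
    rw [Matrix.mulVec_diagonal]
    fin_cases i <;> simp
    field_simp
  refine ⟨fun x => (ψp x).mulVec c, H 0 0, h00, hp.1.mulVec c, ?_, ?_⟩
  · have h := tendsto_mulVec hp.2 c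
    have hc1 := hamp 1
    rw [one_mul] at hc1
    simpa only [Matrix.mulVec_mulVec, hc, hc1] using h
  · have h := tendsto_mulVec hm.2 (H.mulVec c)
    rw [hHc, hamp] at h
    refine h.congr fun x => ?_
    simp only [← hHc, hψ x, Matrix.mulVec_mulVec, Matrix.mul_assoc]

/-- Boundary values joined by reflectionless solutions at all small `z` are almost parallel. -/
lemma exists_norm_sub_le {q₀ : ℝ} {qm qp : EuclideanSpace ℂ (Fin 2)}
    {q : ℝ → EuclideanSpace ℂ (Fin 2)} (hq₀ : 0 < q₀) (hqm : ‖qm‖ = q₀) (hqp : ‖qp‖ = q₀)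
    (hq : ContDiff ℝ 1 q) {B : ℝ} (hB : ∀ x, ‖q x‖ ≤ B) (hbot : ControlsTail atBot q qm)
    (htop : ControlsTail atTop q qp) {ε : ℝ} (hε : 0 < ε) (hε' : 216 * ε ≤ 1) :
    ∃ C, 0 ≤ C ∧ ∀ (z : ℝ) (y : ℝ → Fin 3 → ℂ) (h : ℂ), 0 < z → z ≤ q₀ / 2 → ‖h‖ = 1 →
      (∀ x, HasDerivAt y ((X q₀ z (q x)).mulVec (y x)) x) →
      Tendsto (fun x => (gauge q₀ z qp x).mulVec (y x)) atTop (𝓝 (Pi.single 0 1)) →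
      Tendsto (fun x => (gauge q₀ z qm x).mulVec (y x)) atBot (𝓝 (Pi.single 0 h)) →
      ∀ i, ‖qp i - h * qm i‖ ≤ 1296 * q₀ * ε + C * z := by
  -- The interval `[R₁, R₂]` is fixed before `z`, so the constant of the `O(z)` estimate on it does
  -- not depend on `z`.
  obtain ⟨R₁, hR₁, hR₁'⟩ := ((eventually_norm_sub_planeWave_le hq₀ hqm hbot hε hε').and
    (eventually_le_atBot 0)).exists
  obtain ⟨R₂, hR₂, hR₂'⟩ := ((eventually_norm_sub_planeWave_le hq₀ hqp htop hε hε').and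
    (eventually_ge_atTop 0)).exists
  have hR : R₁ ≤ R₂ := hR₁'.trans hR₂'
  obtain ⟨B', hB'⟩ := (isCompact_Icc (a := R₁) (b := R₂)).exists_bound_of_continuousOn
    (hq.continuous_deriv le_rfl).continuousOn
  have hB0 : 0 ≤ B := (norm_nonneg _).trans (hB 0)
  have hB0' : 0 ≤ B' := (norm_nonneg _).trans (hB' R₁ ⟨le_rfl, hR⟩)
  set M : ℝ := 4 * q₀ * Real.exp (2 * B * (R₂ - R₁)) with hMdef
  have hRR : 0 ≤ R₂ - R₁ := sub_nonneg.2 hR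
  refine ⟨M * (1 + (B' + 2 * B * B) / q₀ ^ 2) * (R₂ - R₁) + 2 * (B * M / q₀ ^ 2),
    by positivity, fun z y h hz hz' hh hy hyp hym i => ?_⟩
  have h₁ := hR₁ z y h hz hz' hh hy hym
  have h₂ := hR₂ z y 1 hz hz' norm_one hy hyp
  -- The plane wave contributes `q₀`, the error `648 * q₀ * ε` at most `3 * q₀`.
  have hy₁ : ‖y R₁‖ ≤ 4 * q₀ := by
    have hw : ‖h • planeWave q₀ z qm R₁‖ ≤ q₀ := by
      rw [norm_smul, hh, one_mul]; exact norm_planeWave_le hq₀ hqm hz hz' R₁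
    have := norm_sub_norm_le (y R₁) (h • planeWave q₀ z qm R₁)
    nlinarith
  have hM : ∀ x ∈ Set.Icc R₁ R₂, ‖y x‖ ≤ M := fun x hx => by
    refine (norm_solution_le hB hy hx).trans ?_
    have hx2 := hx.2
    rw [hMdef]
    gcongr
  have hslow := norm_slow_sub_le hq₀ hz hB (hq.differentiable one_ne_zero) hy hR hB' hM i
  have hwave : ∀ (v : EuclideanSpace ℂ (Fin 2)) (x : ℝ),
      exp (I * (-lam q₀ z * x : ℝ)) * planeWave q₀ z v x i.succ = v i := fun v x => by
    have he : eigenbasis q₀ z v i.succ 0 = v i := by fin_cases i <;> simp [eigenbasis]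
    rw [planeWave, he, ← mul_assoc, ← Complex.exp_add]
    simp
  have hcomp : ∀ (v : EuclideanSpace ℂ (Fin 2)) (x : ℝ) (b : ℂ),
      ‖y x - b • planeWave q₀ z v x‖ ≤ 648 * q₀ * ε →
      ‖exp (I * (-lam q₀ z * x : ℝ)) * y x i.succ - b * v i‖ ≤ 648 * q₀ * ε := fun v x b hb => by
    refine le_trans (le_of_eq ?_) ((norm_le_pi_norm _ i.succ).trans hb)
    rw [← one_mul ‖(y x - b • planeWave q₀ z v x) i.succ‖,
      ← norm_exp_I_mul (-lam q₀ z * x), ← norm_mul, ← hwave v x, Pi.sub_apply, Pi.smul_apply,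
      smul_eq_mul]
    congr 1
    ring
  have c₁ := hcomp qm R₁ h h₁
  have c₂ := hcomp qp R₂ 1 h₂
  rw [one_mul] at c₂
  set p₁ := exp (I * (-lam q₀ z * R₁ : ℝ)) * y R₁ i.succ
  set p₂ := exp (I * (-lam q₀ z * R₂ : ℝ)) * y R₂ i.succ
  calc ‖qp i - h * qm i‖ = ‖-(p₂ - qp i) + (p₁ - h * qm i) + (p₂ - p₁)‖ := by congr 1; ring
    _ ≤ ‖-(p₂ - qp i)‖ + ‖p₁ - h * qm i‖ + ‖p₂ - p₁‖ := norm_add₃_le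
    _ ≤ 648 * q₀ * ε + 648 * q₀ * ε + _ := by
      rw [norm_neg]; exact add_le_add (add_le_add c₂ c₁) hslow
    _ = _ := by ring

/-- Pairing `q₊ = h q₋ + (q₊ - h q₋)` with `q₊` bounds `q₀²` by `|q₊† q₋|` plus `q₀` times the norm
of the difference. That norm is at most `2 * δ` for two components. -/
lemma norm_sq_sub_norm_inner_le {q₀ δ : ℝ} {qm qp : EuclideanSpace ℂ (Fin 2)}
    (hqp : ‖qp‖ = q₀) {h : ℂ} (hh : ‖h‖ = 1)
    (hd : ∀ i, ‖qp i - h * qm i‖ ≤ δ) : q₀ ^ 2 - ‖inner ℂ qp qm‖ ≤ 2 * q₀ * δ := by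
  have hδ : 0 ≤ δ := (norm_nonneg _).trans (hd 0)
  have hd' : ‖qp - h • qm‖ ≤ 2 * δ := by
    rw [EuclideanSpace.norm_eq, Real.sqrt_le_left (by positivity), Fin.sum_univ_two]
    have h0 : ‖(qp - h • qm) 0‖ ≤ δ := hd 0
    have h1 : ‖(qp - h • qm) 1‖ ≤ δ := hd 1
    nlinarith [norm_nonneg ((qp - h • qm) 0), norm_nonneg ((qp - h • qm) 1)]
  have hsplit : inner ℂ qp qp = h * inner ℂ qp qm + inner ℂ qp (qp - h • qm) := by
    rw [inner_sub_right, inner_smul_right]; ring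
  have hn : ‖inner ℂ qp qp‖ = q₀ ^ 2 := by
    rw [inner_self_eq_norm_sq_to_K, hqp]; simp
  have h1 : ‖inner ℂ qp (qp - h • qm)‖ ≤ q₀ * (2 * δ) :=
    (norm_inner_le_norm _ _).trans (by rw [hqp]; gcongr; exact hqp ▸ norm_nonneg qp)
  have h2 := norm_add_le (h * inner ℂ qp qm) (inner ℂ qp (qp - h • qm))
  rw [← hsplit, hn, norm_mul, hh, one_mul] at h2
  linarith

end CoupledHirota

end

theorem theorem3 (σ q₀ : ℝ) (hq₀ : 0 < q₀)
    (qm qp : EuclideanSpace ℂ (Fin 2)) (hqm : ‖qm‖ = q₀) (hqp : ‖qp‖ = q₀)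
    (hnonpar : ‖inner ℂ qp qm‖ / q₀ ^ 2 < 1)
    (q : ℝ → ℝ → EuclideanSpace ℂ (Fin 2))
    (hsol : CoupledHirota.IsSolution σ q₀ q)
    (hbot : ∀ t, Tendsto (fun x => q x t) atBot (𝓝 qm))
    (htop : ∀ t, Tendsto (fun x => q x t) atTop (𝓝 qp))
    (hintm : ∀ t, IntegrableOn (fun x => q x t - qm) (Set.Iio 0))
    (hintp : ∀ t, IntegrableOn (fun x => q x t - qp) (Set.Ioi 0))
    (t : ℝ) :
    (∀ z : ℝ, z ≠ 0 → z ≠ q₀ → z ≠ -q₀ →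
        ∃! H, CoupledHirota.IsScatteringMatrix σ q₀ qm qp q t z H) ∧
    ∀ H : ℝ → Matrix (Fin 3) (Fin 3) ℂ,
      (∀ z : ℝ, z ≠ 0 → z ≠ q₀ → z ≠ -q₀ →
        CoupledHirota.IsScatteringMatrix σ q₀ qm qp q t z (H z)) →
      ¬ ∀ z : ℝ, z ≠ 0 → z ≠ q₀ → z ≠ -q₀ → CoupledHirota.ReflectionVanishes (H z) := by
  have hq : ContDiff ℝ 1 fun x => q x t := (hsol.contDiff_x t).of_le (by norm_num)
  obtain ⟨B, hB⟩ := CoupledHirota.exists_norm_bound hq.continuous (hbot t) (htop t)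
  have hcm := CoupledHirota.controlsTail_atBot hq.continuous (hintm t)
  have hcp := CoupledHirota.controlsTail_atTop hq.continuous (hintp t)
  refine ⟨fun z hz h1 h2 => CoupledHirota.existsUnique_isScatteringMatrix hq₀ hqm hqp hz h1 h2
    hq.continuous hB hcm hcp, fun H hH hr => ?_⟩
  rw [div_lt_one (by positivity)] at hnonpar
  set η : ℝ := q₀ ^ 2 - ‖inner ℂ qp qm‖ with hη
  have hη0 : 0 < η := sub_pos.2 hnonpar
  -- The final bound is `2 q₀ (1296 q₀ ε + C z)`. This `ε` makes its first part at most `0.2592 η`,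
  -- and the choice of `z` below makes the second at most `η / 2`, so the sum is less than `η`.
  set ε : ℝ := min (1 / 216) (η / (10000 * q₀ ^ 2)) with hεdef
  have hε0 : 0 < ε := by positivity
  have hε1 : 216 * ε ≤ 1 := by linarith [min_le_left (1 / 216) (η / (10000 * q₀ ^ 2))]
  have hε2 : ε * (10000 * q₀ ^ 2) ≤ η :=
    (le_div_iff₀ (by positivity)).1 (min_le_right (1 / 216) (η / (10000 * q₀ ^ 2)))
  obtain ⟨C, hC0, hC⟩ := CoupledHirota.exists_norm_sub_le hq₀ hqm hqp hq hB hcm hcp hε0 hε1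
  set z : ℝ := min (q₀ / 2) (η / (4 * q₀ * (C + 1))) with hzdef
  have hz0 : 0 < z := by positivity
  have hz1 : z ≤ q₀ / 2 := min_le_left _ _
  have hz2 : z * (4 * q₀ * (C + 1)) ≤ η :=
    (le_div_iff₀ (by positivity)).1 (min_le_right (q₀ / 2) (η / (4 * q₀ * (C + 1))))
  have h1 : z ≠ q₀ := by intro e; linarith
  have h2 : z ≠ -q₀ := by intro e; linarith
  obtain ⟨y, h, hh, hy, hyp, hym⟩ := CoupledHirota.exists_transparent_solution hq₀ hqm hqp
    hz0.ne' h1 h2 (hH z hz0.ne' h1 h2) (hr z hz0.ne' h1 h2)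
  have hfin := CoupledHirota.norm_sq_sub_norm_inner_le hqp hh
    (hC z y h hz0 hz1 hh hy hyp hym)
  have hz3 : 0 < z * q₀ := by positivity
  rw [← hη] at hfin
  nlinarith
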